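/- Let $\|\cdot\|$ denote the spectral norm of a matrix and $\|A\|_F=\sqrt{\mathrm{Tr}(A^*A)}$ its Frobenius norm. For every $\epsilon>0$ there is a constant $C_\epsilon>0$, depending only on $\epsilon$, such that the following holds. Let $g_1,\ldots,g_n$ be i.i.d. standard Gaussian random variables and let $A_1,\ldots,A_n$ be real $d\times d$ matrices with $\mathrm{Tr}(A_{k_1}A_{k_2}^*)=0$ for all $k_1\neq k_2$ in $\{1,\ldots,n\}$. Then \[\mathbb{E}\Big\|\sum_{k=1}^n g_kA_k\Big\|\le C_\epsilon\left(\Big\|\sum_{k=1}^n A_k^*A_k\Big\|^{1/2}+\Big\|\sum_{k=1}^n A_kA_k^*\Big\|^{1/2}+d^{\epsilon}\max_{1\le k\le n}\|A_k\|_F\right).\] Moreover, there is a universal constant $C>0$ such that, if in addition all entries of $A_1,\ldots,A_n$ are nonnegative, then \[\mathbb{E}\Big\|\sum_{k=1}^n g_kA_k\Big\|\le C\left(\Big\|\sum_{k=1}^n A_k^*A_k\Big\|^{1/2}+\Big\|\sum_{k=1}^n A_kA_k^*\Big\|^{1/2}+(\log d)^{2}\max_{1\le k\le n}\|A_k\|_F\right).\]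 -/

import Mathlib

universe u

open MeasureTheory ProbabilityTheory
open scoped Matrix

-- `‖A‖` for a matrix `A` is the spectral norm (operator norm for the Euclidean norm).
open scoped Matrix.Norms.L2Operator

/-- The Frobenius norm `‖A‖_F = √(Tr (A* A))` of a real matrix. -/
noncomputable def frobeniusNorm {d : ℕ} (A : Matrix (Fin d) (Fin d) ℝ) : ℝ :=
  √((Aᵀ * A).trace)

/-- The matrices `A k` are pairwise orthogonal for `⟨A, B⟩ = Tr (A B*)`. -/
def FrobeniusOrthogonal {n d : ℕ} (A : Fin n → Matrix (Fin d) (Fin d) ℝ) : Prop :=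
  ∀ k₁ k₂, k₁ ≠ k₂ → (A k₁ * (A k₂)ᵀ).trace = 0

/-- The random variables `g k` are i.i.d. standard Gaussians. -/
def IsIIDStdGaussian {Ω : Type*} [MeasurableSpace Ω] (μ : Measure Ω) {n : ℕ}
    (g : Fin n → Ω → ℝ) : Prop :=
  (∀ k, HasLaw (g k) (gaussianReal 0 1) μ) ∧ iIndepFun g μ

/-!
# Norms of Gaussian series with Frobenius-orthogonal matrix coefficients

The proof bounds `E Tr Z ^ N` for the symmetric dilation `Z` of the series `∑ g k A k`, with `N`
even and of order `log d`. It gives the factor `(log d) ^ 2` in front of the Frobenius term for all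
orthogonal families, and `(log d) ^ 2` is at most a constant times `d ^ ε`.

Write `S(M) = ∑ A k M A k`, let `s` bound `∑ A k ^ 2`, and let `V` bound the covariance operator of
the series on matrices with the Frobenius inner product; for orthogonal coefficients `V` is the
largest `‖A k‖_F ^ 2`, up to a factor `2` from the dilation. Gaussian integration by parts gives the Schwinger-Dyson equation
`E Z ^ (q + 1) = ∑ E (S(Z ^ a) Z ^ b)`, over `a + b = q - 1`. If the two powers of `Z` were
independent this would be a Catalan recursion for the matrices `M a = E Z ^ a`, with growth
governed by `s` alone, because `‖S(M)‖ ≤ s ‖M‖`. The correction is a covariance. Rotating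
`x` into an independent copy `y` along `cos θ x + sin θ y` turns it into words
`∑ A k Z ^ c A l Z ^ c' A k Z' ^ e A l Z' ^ e'` in which the contractions over `k` and `l` cross
(`abs_sum_covariance_le`, `CoeffBound.abs_trace_decoupling_le`). A crossing gains a factor `s V`,
both as a bilinear form (`CoeffBound.bilin_crossing_le`) and, in eigenbases of the two matrices,
for the trace (`CoeffBound.abs_trace_crossing_le`); both estimates are the Cauchy-Schwarz
inequality applied to `CoeffBound.sum_sq_tensor_le`.

Normalize so that `E Tr Z ^ N` equals the dimension, and suppose that `s` and `N ^ 3 V` are small.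
Since the dimension is at most `2 ^ N`, errors in operator norm lose only a factor `2 ^ q` at degree
`q`, so the perturbed recursion bounds the sum of `2 ^ q ‖M q‖` by `2` up to degrees
`q = m` with `2 ^ m` of order `N` (`CoeffBound.sum_norm_moments_le`). In the equation for `E Tr Z ^ N`
the terms `Tr (S(M a) M b)` with `a < m` or `b < m` are bounded through `‖M a‖` or `‖M b‖`. The
remaining ones are bounded by the terms at the edge `m` of the middle range, a form of convexity
in the exponent, and `‖M m‖ ≤ 2 / N` compensates for their number. The errors here use the trace
estimate, which loses no dimension factor. The total is smaller than the dimension, a contradiction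
(`CoeffBound.trace_moment_ne`); rescaling turns this into a bound for the moment.
-/

/-! ### Moments of the standard Gaussian -/

lemma integrable_pow_gaussianReal (n : ℕ) :
    Integrable (fun x : ℝ => x ^ n) (gaussianReal 0 1) := by
  have h := (memLp_id_gaussianReal (μ := 0) (v := 1) (n : NNReal)).integrable_norm_pow'
  refine (integrable_norm_iff (by fun_prop)).1 ?_
  simpa using h

/-- The moment recursion of the standard Gaussian, by partial integration. -/
lemma integral_pow_succ_gaussianReal (n : ℕ) :
    ∫ x, x ^ (n + 1) ∂gaussianReal 0 1 = n * ∫ x, x ^ (n - 1) ∂gaussianReal 0 1 := by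
  have hI : ∀ m : ℕ, Integrable (fun x : ℝ => gaussianPDFReal 0 1 x * x ^ m) := by
    intro m
    have h := integrable_pow_gaussianReal m
    rw [gaussianReal_of_var_ne_zero _ one_ne_zero] at h
    rw [integrable_withDensity_iff_integrable_smul₀' (by fun_prop)
      (.of_forall fun x => by simp [gaussianPDF])] at h
    simpa [gaussianPDF, ENNReal.toReal_ofReal, gaussianPDFReal_nonneg] using h
  have hd : ∀ x : ℝ,
      HasDerivAt (fun x => -gaussianPDFReal 0 1 x) (gaussianPDFReal 0 1 x * x) x := by
    intro x
    have : HasDerivAt (fun x : ℝ => -(x - 0) ^ 2 / (2 * (1 : NNReal))) (-x) x := by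
      have := ((((hasDerivAt_id x).sub_const 0).pow 2).neg).div_const (2 * ((1 : NNReal) : ℝ))
      refine this.congr_deriv ?_
      simp
      ring
    have := (((this.exp).const_mul (√(2 * Real.pi * (1 : NNReal)))⁻¹)).neg
    refine this.congr_deriv ?_
    simp [gaussianPDFReal]
    ring
  have key := integral_mul_deriv_eq_deriv_mul_of_integrable (u := fun x : ℝ => x ^ n)
    (u' := fun x => n * x ^ (n - 1)) (v := fun x => -gaussianPDFReal 0 1 x)
    (v' := fun x => gaussianPDFReal 0 1 x * x)
    (fun x _ => by simpa using hasDerivAt_pow n x) (fun x _ => hd x) ?_ ?_ ?_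
  · rw [integral_gaussianReal_eq_integral_smul one_ne_zero,
      integral_gaussianReal_eq_integral_smul one_ne_zero, ← integral_const_mul]
    simp only [smul_eq_mul]
    calc _ = ∫ x : ℝ, x ^ n * (gaussianPDFReal 0 1 x * x) := by
          congr 1; ext x; ring
      _ = _ := by
          rw [key, ← integral_neg]; congr 1; ext x; ring
  · refine (hI (n + 1)).congr (.of_forall fun x => ?_)
    simp only [Pi.mul_apply]; ring
  · refine ((hI (n - 1)).const_mul (-(n : ℝ))).congr (.of_forall fun x => ?_)
    simp only [Pi.mul_apply]; ring
  · refine ((hI n).neg).congr (.of_forall fun x => ?_)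
    simp only [Pi.mul_apply, Pi.neg_apply]; ring

/-! ### Rotating one copy of the variables into another -/

section Rotation

variable {κ : Type*}

/-- Substitution of `cos θ x + sin θ y` into a polynomial, where `x` and `y` are two copies of
the variables. For independent Gaussian `x`, `y` this rotates from the first copy to the second. -/
noncomputable def rotate (θ : ℝ) : MvPolynomial κ ℝ →ₐ[ℝ] MvPolynomial (κ ⊕ κ) ℝ :=
  MvPolynomial.aeval fun l =>
    MvPolynomial.C (Real.cos θ) * MvPolynomial.X (Sum.inl l) +
      MvPolynomial.C (Real.sin θ) * MvPolynomial.X (Sum.inr l)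

lemma rotate_X (θ : ℝ) (l : κ) : rotate θ (MvPolynomial.X l) =
    MvPolynomial.C (Real.cos θ) * MvPolynomial.X (Sum.inl l) +
      MvPolynomial.C (Real.sin θ) * MvPolynomial.X (Sum.inr l) := by
  simp [rotate]

lemma rotate_zero (p : MvPolynomial κ ℝ) : rotate 0 p = MvPolynomial.rename Sum.inl p := by
  have h : (rotate 0 : MvPolynomial κ ℝ →ₐ[ℝ] _) = MvPolynomial.rename Sum.inl :=
    MvPolynomial.algHom_ext fun i => by simp [rotate_X]
  rw [h]

lemma rotate_pi_div_two (p : MvPolynomial κ ℝ) :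
    rotate (Real.pi / 2) p = MvPolynomial.rename Sum.inr p := by
  have h : (rotate (Real.pi / 2) : MvPolynomial κ ℝ →ₐ[ℝ] _) = MvPolynomial.rename Sum.inr :=
    MvPolynomial.algHom_ext fun i => by simp [rotate_X]
  rw [h]

/-- The velocity `- sin θ x + cos θ y` of the rotation. -/
noncomputable def rotateVel (θ : ℝ) (l : κ) : MvPolynomial (κ ⊕ κ) ℝ :=
  MvPolynomial.C (-Real.sin θ) * MvPolynomial.X (Sum.inl l) +
    MvPolynomial.C (Real.cos θ) * MvPolynomial.X (Sum.inr l)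

lemma pderiv_inl_rotate (θ : ℝ) (l : κ) (G : MvPolynomial κ ℝ) :
    MvPolynomial.pderiv (Sum.inl l) (rotate θ G) =
      MvPolynomial.C (Real.cos θ) * rotate θ (MvPolynomial.pderiv l G) := by
  classical
  induction G using MvPolynomial.induction_on with
  | C a => simp [rotate, MvPolynomial.algebraMap_eq]
  | add p q hp hq => simp only [map_add, hp, hq]; ring
  | mul_X p i hp =>
    rw [map_mul, MvPolynomial.pderiv_mul, hp, MvPolynomial.pderiv_mul, map_add, map_mul, map_mul,
      rotate_X]
    by_cases h : i = l
    · subst h; simp [MvPolynomial.pderiv_X]; ring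
    · simp [MvPolynomial.pderiv_X, h]; ring

lemma pderiv_inr_rotate (θ : ℝ) (l : κ) (G : MvPolynomial κ ℝ) :
    MvPolynomial.pderiv (Sum.inr l) (rotate θ G) =
      MvPolynomial.C (Real.sin θ) * rotate θ (MvPolynomial.pderiv l G) := by
  classical
  induction G using MvPolynomial.induction_on with
  | C a => simp [rotate, MvPolynomial.algebraMap_eq]
  | add p q hp hq => simp only [map_add, hp, hq]; ring
  | mul_X p i hp =>
    rw [map_mul, MvPolynomial.pderiv_mul, hp, MvPolynomial.pderiv_mul, map_add, map_mul, map_mul,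
      rotate_X]
    by_cases h : i = l
    · subst h; simp [MvPolynomial.pderiv_X]; ring
    · simp [MvPolynomial.pderiv_X, h]; ring

lemma pderiv_inr_rename_inl (l : κ) (F : MvPolynomial κ ℝ) :
    MvPolynomial.pderiv (Sum.inr l) (MvPolynomial.rename (Sum.inl : κ → κ ⊕ κ) F) = 0 := by
  classical
  induction F using MvPolynomial.induction_on with
  | C a => simp
  | add p q hp hq => simp [hp, hq]
  | mul_X p i hp => simp [hp, MvPolynomial.pderiv_X]

end Rotation

/-! ### Expectations of polynomials in independent Gaussians -/

section GaussianPolynomial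

variable {κ : Type*} [Fintype κ]

/-- The law of a vector of independent standard Gaussians indexed by `κ`. -/
noncomputable def stdGaussianPi (κ : Type*) [Fintype κ] : Measure (κ → ℝ) :=
  Measure.pi fun _ => gaussianReal 0 1

instance : IsProbabilityMeasure (stdGaussianPi κ) := by
  unfold stdGaussianPi; infer_instance

lemma eval_monomial_prod (m : κ →₀ ℕ) (a : ℝ) (x : κ → ℝ) :
    MvPolynomial.eval x (MvPolynomial.monomial m a) = a * ∏ i, x i ^ m i := by
  rw [MvPolynomial.eval_monomial, Finsupp.prod_fintype _ _ (by simp)]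

lemma integrable_eval_mvPolynomial (p : MvPolynomial κ ℝ) :
    Integrable (fun x => MvPolynomial.eval x p) (stdGaussianPi κ) := by
  induction p using MvPolynomial.induction_on' with
  | monomial m a =>
    simp only [eval_monomial_prod]
    exact (Integrable.fintype_prod (f := fun i (x : ℝ) => x ^ m i)
      fun i => integrable_pow_gaussianReal _).const_mul a
  | add p q hp hq => simp only [map_add]; exact hp.add hq

/-- The expectation of a polynomial in independent standard Gaussians. -/
noncomputable def gaussianE : MvPolynomial κ ℝ →ₗ[ℝ] ℝ where
  toFun p := ∫ x, MvPolynomial.eval x p ∂stdGaussianPi κ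
  map_add' p q := by
    simpa using integral_add (integrable_eval_mvPolynomial p) (integrable_eval_mvPolynomial q)
  map_smul' c p := by
    simp [integral_const_mul]

lemma gaussianE_apply (p : MvPolynomial κ ℝ) :
    gaussianE p = ∫ x, MvPolynomial.eval x p ∂stdGaussianPi κ := rfl

lemma gaussianE_mono {p q : MvPolynomial κ ℝ}
    (h : ∀ x, MvPolynomial.eval x p ≤ MvPolynomial.eval x q) : gaussianE p ≤ gaussianE q :=
  integral_mono (integrable_eval_mvPolynomial p) (integrable_eval_mvPolynomial q) h

lemma gaussianE_C (c : ℝ) : gaussianE (MvPolynomial.C c : MvPolynomial κ ℝ) = c := by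
  simp [gaussianE_apply]

lemma gaussianE_C_mul (c : ℝ) (p : MvPolynomial κ ℝ) :
    gaussianE (MvPolynomial.C c * p) = c * gaussianE p := by
  rw [← MvPolynomial.smul_eq_C_mul, map_smul, smul_eq_mul]

lemma gaussianE_monomial (m : κ →₀ ℕ) (a : ℝ) :
    gaussianE (MvPolynomial.monomial m a) = a * ∏ i, ∫ x, x ^ m i ∂gaussianReal 0 1 := by
  simp only [gaussianE_apply, eval_monomial_prod, integral_const_mul, stdGaussianPi]
  rw [integral_fintype_prod_eq_prod (fun i (x : ℝ) => x ^ m i)]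

/-- Gaussian integration by parts. -/
lemma gaussianE_X_mul (i : κ) (p : MvPolynomial κ ℝ) :
    gaussianE (MvPolynomial.X i * p) = gaussianE (MvPolynomial.pderiv i p) := by
  classical
  induction p using MvPolynomial.induction_on' with
  | monomial m a =>
    rw [MvPolynomial.pderiv_monomial, MvPolynomial.X, MvPolynomial.monomial_mul,
      gaussianE_monomial, gaussianE_monomial, one_mul, mul_assoc]
    congr 1
    rw [← Finset.mul_prod_erase _ _ (Finset.mem_univ i),
      ← Finset.mul_prod_erase (a := i) _ _ (Finset.mem_univ i), ← mul_assoc]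
    congr 1
    · simp [add_comm 1, integral_pow_succ_gaussianReal]
    · refine Finset.prod_congr rfl fun j hj => ?_
      have : j ≠ i := Finset.ne_of_mem_erase hj
      simp [this.symm]
  | add p q hp hq => rw [mul_add, map_add, map_add, map_add, hp, hq]

variable {κ' : Type*} [Fintype κ']

lemma gaussianE_rename_inl_mul_rename_inr (p : MvPolynomial κ ℝ) (q : MvPolynomial κ' ℝ) :
    gaussianE (MvPolynomial.rename Sum.inl p * MvPolynomial.rename Sum.inr q) =
      gaussianE p * gaussianE q := by
  classical
  induction p using MvPolynomial.induction_on' with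
  | monomial m a =>
    induction q using MvPolynomial.induction_on' with
    | monomial m' b =>
      rw [MvPolynomial.rename_monomial, MvPolynomial.rename_monomial, MvPolynomial.monomial_mul,
        gaussianE_monomial, gaussianE_monomial, gaussianE_monomial, Fintype.prod_sum_type]
      have h1 : ∀ i : κ, (Finsupp.mapDomain Sum.inl m +
          Finsupp.mapDomain Sum.inr m' : κ ⊕ κ' →₀ ℕ) (Sum.inl i) = m i := by
        intro i
        rw [Finsupp.add_apply, Finsupp.mapDomain_apply Sum.inl_injective,
          Finsupp.mapDomain_of_notMem_range _ _ (by simp), add_zero]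
      have h2 : ∀ i : κ', (Finsupp.mapDomain Sum.inl m +
          Finsupp.mapDomain Sum.inr m' : κ ⊕ κ' →₀ ℕ) (Sum.inr i) = m' i := by
        intro i
        rw [Finsupp.add_apply, Finsupp.mapDomain_apply Sum.inr_injective,
          Finsupp.mapDomain_of_notMem_range _ _ (by simp), zero_add]
      simp only [h1, h2]
      ring
    | add p q hp hq => rw [map_add, mul_add, map_add, map_add, hp, hq, mul_add]
  | add p q hp hq => rw [map_add, add_mul, map_add, map_add, hp, hq, add_mul]

lemma gaussianE_rename_inl (p : MvPolynomial κ ℝ) :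
    gaussianE (MvPolynomial.rename (Sum.inl : κ → κ ⊕ κ') p) = gaussianE p := by
  have h := gaussianE_rename_inl_mul_rename_inr (κ' := κ') p 1
  have h1 : gaussianE (1 : MvPolynomial κ' ℝ) = 1 := gaussianE_C 1
  simpa [h1] using h

/-- Differentiation along the rotation. The factor `F` in both copies of the variables is arbitrary,
so that the induction on `G` can move variables into it. -/
lemma hasDerivAt_gaussianE_mul_rotate (G : MvPolynomial κ ℝ) (θ : ℝ) :
    ∀ F : MvPolynomial (κ ⊕ κ) ℝ, HasDerivAt (fun θ => gaussianE (F * rotate θ G))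
      (gaussianE (F * ∑ l, rotate θ (MvPolynomial.pderiv l G) * rotateVel θ l)) θ := by
  classical
  induction G using MvPolynomial.induction_on with
  | C a =>
    intro F
    simpa [rotate] using hasDerivAt_const θ (gaussianE (F * (MvPolynomial.C a)))
  | add p q hp hq =>
    intro F
    simp only [map_add, mul_add, add_mul, Finset.sum_add_distrib]
    exact (hp F).add (hq F)
  | mul_X p i hp =>
    intro F
    have h1 : ∀ θ, gaussianE (F * rotate θ (p * MvPolynomial.X i)) =
        Real.cos θ * gaussianE ((F * MvPolynomial.X (Sum.inl i)) * rotate θ p) +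
        Real.sin θ * gaussianE ((F * MvPolynomial.X (Sum.inr i)) * rotate θ p) := by
      intro θ
      rw [map_mul (rotate θ), rotate_X, ← gaussianE_C_mul, ← gaussianE_C_mul, ← map_add]
      congr 1; ring
    simp only [h1]
    refine (((Real.hasDerivAt_cos θ).mul (hp (F * MvPolynomial.X (Sum.inl i)))).add
      ((Real.hasDerivAt_sin θ).mul (hp (F * MvPolynomial.X (Sum.inr i))))).congr_deriv ?_
    simp only [← gaussianE_C_mul, ← map_add]
    congr 1
    have h2 : ∑ l, rotate θ (MvPolynomial.pderiv l (p * MvPolynomial.X i)) * rotateVel θ l =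
        (∑ l, rotate θ (MvPolynomial.pderiv l p) * rotateVel θ l) * rotate θ (MvPolynomial.X i) +
          rotate θ p * rotateVel θ i := by
      simp only [MvPolynomial.pderiv_mul, MvPolynomial.pderiv_X, map_add, map_mul, add_mul,
        Finset.sum_add_distrib]
      congr 1
      · rw [Finset.sum_mul]
        exact Finset.sum_congr rfl fun l _ => by ring
      · rw [Finset.sum_eq_single i]
        · simp
        · intro l _ hl; simp [hl.symm]
        · simp
    rw [h2, rotate_X, rotateVel]
    ring

/-- Along the rotation, `E F(x) G(x_θ)` has derivative `- sin θ ∑ E (∂_l F)(x) (∂_l G)(x_θ)`. -/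
lemma hasDerivAt_gaussianE_rotate (F G : MvPolynomial κ ℝ) (θ : ℝ) :
    HasDerivAt (fun θ => gaussianE (MvPolynomial.rename Sum.inl F * rotate θ G))
      (-Real.sin θ * ∑ l, gaussianE (MvPolynomial.rename Sum.inl (MvPolynomial.pderiv l F) *
        rotate θ (MvPolynomial.pderiv l G))) θ := by
  refine (hasDerivAt_gaussianE_mul_rotate G θ _).congr_deriv ?_
  rw [Finset.mul_sum, map_sum, Finset.mul_sum]
  refine Finset.sum_congr rfl fun l _ => ?_
  set F' := MvPolynomial.rename (Sum.inl : κ → κ ⊕ κ) F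
  set H := rotate θ (MvPolynomial.pderiv l G)
  have h1 : F' * (H * rotateVel θ l) =
      MvPolynomial.C (-Real.sin θ) * (MvPolynomial.X (Sum.inl l) * (F' * H)) +
        MvPolynomial.C (Real.cos θ) * (MvPolynomial.X (Sum.inr l) * (F' * H)) := by
    rw [rotateVel]; ring
  rw [h1, map_add, gaussianE_C_mul, gaussianE_C_mul, gaussianE_X_mul, gaussianE_X_mul,
    MvPolynomial.pderiv_mul, MvPolynomial.pderiv_mul, pderiv_inl_rotate, pderiv_inr_rotate,
    pderiv_inr_rename_inl, MvPolynomial.pderiv_rename Sum.inl_injective]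
  simp only [map_add, zero_mul, mul_left_comm F', gaussianE_C_mul, map_zero]
  ring

/-- A rotation of two independent Gaussian vectors preserves the law. -/
lemma gaussianE_rotate (G : MvPolynomial κ ℝ) (θ : ℝ) : gaussianE (rotate θ G) = gaussianE G := by
  have hd : ∀ θ, HasDerivAt (fun θ => gaussianE (rotate θ G)) 0 θ := by
    intro θ
    simpa using hasDerivAt_gaussianE_rotate 1 G θ
  have := is_const_of_deriv_eq_zero (fun θ => (hd θ).differentiableAt) (fun θ => (hd θ).deriv) θ 0
  rw [this, rotate_zero, gaussianE_rename_inl]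

/-- A Gaussian covariance bound: the sum of the covariances of `F i` and `G i` is controlled by
gradients evaluated at a pair of correlated Gaussian vectors. -/
lemma abs_sum_covariance_le {α : Type*} (s : Finset α) (F G : α → MvPolynomial κ ℝ) {B : ℝ}
    (hB : ∀ θ, |gaussianE (∑ i ∈ s, ∑ l, MvPolynomial.rename Sum.inl (MvPolynomial.pderiv l (F i)) *
        rotate θ (MvPolynomial.pderiv l (G i)))| ≤ B) :
    |∑ i ∈ s, (gaussianE (F i * G i) - gaussianE (F i) * gaussianE (G i))| ≤ 2 * B := by
  have hB0 : 0 ≤ B := (abs_nonneg _).trans (hB 0)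
  -- `φ 0 - φ (π / 2)` is the sum of the covariances
  set φ : ℝ → ℝ := fun θ => ∑ i ∈ s, gaussianE (MvPolynomial.rename Sum.inl (F i) * rotate θ (G i))
  have hd : ∀ θ, HasDerivAt φ (∑ i ∈ s, (-Real.sin θ * ∑ l,
      gaussianE (MvPolynomial.rename Sum.inl (MvPolynomial.pderiv l (F i)) *
        rotate θ (MvPolynomial.pderiv l (G i))))) θ := fun θ =>
    HasDerivAt.fun_sum fun i _ => hasDerivAt_gaussianE_rotate (F i) (G i) θ
  have hmv := Convex.norm_image_sub_le_of_norm_hasDerivWithin_le (f := φ) (s := Set.univ) (C := B)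
    (x := Real.pi / 2) (y := 0) (fun θ _ => (hd θ).hasDerivWithinAt) (fun θ _ => by
      rw [← Finset.mul_sum, norm_mul]
      have := hB θ
      simp only [map_sum] at this
      calc _ ≤ 1 * B := by
            refine mul_le_mul ?_ this (norm_nonneg _) zero_le_one
            simpa using Real.abs_sin_le_one θ
        _ = B := one_mul B) convex_univ trivial trivial
  have e : φ 0 - φ (Real.pi / 2) =
      ∑ i ∈ s, (gaussianE (F i * G i) - gaussianE (F i) * gaussianE (G i)) := by
    simp only [φ, rotate_zero, rotate_pi_div_two, gaussianE_rename_inl_mul_rename_inr, ← map_mul,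
      gaussianE_rename_inl, Finset.sum_sub_distrib]
  rw [← e]
  refine hmv.trans ?_
  rw [mul_comm]
  refine mul_le_mul_of_nonneg_right ?_ hB0
  rw [zero_sub, norm_neg, Real.norm_eq_abs, abs_of_nonneg (by positivity)]
  linarith [Real.pi_le_four]

end GaussianPolynomial

/-! ### Operator norm and Frobenius norm estimates -/

section MatrixBounds

variable {ι κ : Type*} [Fintype ι] [DecidableEq ι] [Fintype κ]

lemma matrix_norm_one_le : ‖(1 : Matrix ι ι ℝ)‖ ≤ 1 := by
  rcases isEmpty_or_nonempty ι with h | h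
  · rw [Subsingleton.elim (1 : Matrix ι ι ℝ) 0]; simp
  · simp

lemma matrix_norm_transpose (M : Matrix ι ι ℝ) : ‖Mᵀ‖ = ‖M‖ := by
  rw [← Matrix.conjTranspose_eq_transpose_of_trivial, Matrix.l2_opNorm_conjTranspose]

lemma sum_sq_mulVec_le (M : Matrix ι ι ℝ) (w : ι → ℝ) :
    ∑ i, (M *ᵥ w) i ^ 2 ≤ ‖M‖ ^ 2 * ∑ i, w i ^ 2 := by
  have h := Matrix.l2_opNorm_mulVec M (WithLp.toLp 2 w)
  have h2 := pow_le_pow_left₀ (norm_nonneg _) h 2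
  rw [mul_pow, EuclideanSpace.norm_sq_eq, EuclideanSpace.norm_sq_eq] at h2
  simpa using h2

lemma matrix_norm_le_of_bilin (M : Matrix ι ι ℝ) {m : ℝ} (hm : 0 ≤ m)
    (h : ∀ u w : ι → ℝ, u ⬝ᵥ M *ᵥ w ≤ m * (√(∑ i, u i ^ 2) * √(∑ i, w i ^ 2))) : ‖M‖ ≤ m := by
  rw [Matrix.l2_opNorm_def]
  refine ContinuousLinearMap.opNorm_le_bound _ hm fun x => ?_
  have e : ∀ v : ι → ℝ, √(∑ i, v i ^ 2) = ‖(WithLp.toLp 2 v : EuclideanSpace ℝ ι)‖ := by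
    intro v; simp [EuclideanSpace.norm_eq]
  have h1 := h (M *ᵥ x.ofLp) x.ofLp
  rw [e, e] at h1
  have h2 : (M *ᵥ x.ofLp) ⬝ᵥ (M *ᵥ x.ofLp) =
      ‖(WithLp.toLp 2 (M *ᵥ x.ofLp) : EuclideanSpace ℝ ι)‖ ^ 2 := by
    rw [EuclideanSpace.norm_sq_eq]; simp [dotProduct, sq]
  rw [h2] at h1
  change ‖(WithLp.toLp 2 (M *ᵥ x.ofLp) : EuclideanSpace ℝ ι)‖ ≤ _
  have h3 : (WithLp.toLp 2 x.ofLp : EuclideanSpace ℝ ι) = x := rfl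
  rw [h3] at h1
  set a := ‖(WithLp.toLp 2 (M *ᵥ x.ofLp) : EuclideanSpace ℝ ι)‖
  have ha : 0 ≤ a := norm_nonneg _
  have hx : 0 ≤ m * ‖x‖ := by positivity
  rcases ha.eq_or_lt with h0 | h0
  · rw [← h0]; exact hx
  · nlinarith

/-- The squared Frobenius norm. -/
def frobSq (M : Matrix ι ι ℝ) : ℝ := ∑ i, ∑ j, M i j ^ 2

omit [DecidableEq ι] in
lemma frobSq_nonneg (M : Matrix ι ι ℝ) : 0 ≤ frobSq M :=
  Finset.sum_nonneg fun _ _ => Finset.sum_nonneg fun _ _ => sq_nonneg _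

omit [DecidableEq ι] in
lemma frobSq_transpose (M : Matrix ι ι ℝ) : frobSq Mᵀ = frobSq M := by
  unfold frobSq; rw [Finset.sum_comm]; rfl

lemma frobSq_mul_le_left (B M : Matrix ι ι ℝ) : frobSq (B * M) ≤ ‖B‖ ^ 2 * frobSq M := by
  unfold frobSq
  rw [Finset.sum_comm, Finset.sum_comm (f := fun i j => M i j ^ 2), Finset.mul_sum]
  exact Finset.sum_le_sum fun j _ => sum_sq_mulVec_le B (fun i => M i j)

lemma frobSq_mul_le_right (M B : Matrix ι ι ℝ) : frobSq (M * B) ≤ ‖B‖ ^ 2 * frobSq M := by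
  rw [← frobSq_transpose, Matrix.transpose_mul, ← frobSq_transpose M, ← matrix_norm_transpose B]
  exact frobSq_mul_le_left _ _

/-- Bounds on the coefficients `A k` of a Gaussian series of symmetric matrices: `s` bounds the
matrix variance `∑ A k ^ 2` and `V` bounds the covariance operator `∑ (A k) (A k)ᵀ` acting on
matrices with the Frobenius inner product (stated for the adjoint map `c ↦ ∑ c k A k`). -/
structure CoeffBound (A : κ → Matrix ι ι ℝ) (s V : ℝ) : Prop where
  symm : ∀ k, (A k)ᵀ = A k
  variance_nonneg : 0 ≤ s
  covariance_nonneg : 0 ≤ V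
  variance : ∀ w : ι → ℝ, ∑ k, ∑ i, (A k *ᵥ w) i ^ 2 ≤ s * ∑ i, w i ^ 2
  covariance : ∀ c : κ → ℝ, frobSq (∑ k, c k • A k) ≤ V * ∑ k, c k ^ 2

/-- The completely positive map `M ↦ ∑ A k M A k`. -/
def covMap (A : κ → Matrix ι ι ℝ) (M : Matrix ι ι ℝ) : Matrix ι ι ℝ := ∑ k, A k * M * A k

variable {A : κ → Matrix ι ι ℝ} {s V : ℝ}

omit [DecidableEq ι] in
lemma CoeffBound.dotProduct_mulVec (h : CoeffBound A s V) (k : κ) (u w : ι → ℝ) :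
    u ⬝ᵥ A k *ᵥ w = (A k *ᵥ u) ⬝ᵥ w := by
  rw [Matrix.dotProduct_mulVec, ← Matrix.mulVec_transpose, h.symm]

lemma CoeffBound.norm_covMap_le (h : CoeffBound A s V) (M : Matrix ι ι ℝ) :
    ‖covMap A M‖ ≤ s * ‖M‖ := by
  refine matrix_norm_le_of_bilin _ (mul_nonneg h.variance_nonneg (norm_nonneg _)) fun u w => ?_
  have e : u ⬝ᵥ covMap A M *ᵥ w = ∑ k, ∑ i, (A k *ᵥ u) i * (M *ᵥ (A k *ᵥ w)) i := by
    rw [covMap, Matrix.sum_mulVec, dotProduct_sum]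
    refine Finset.sum_congr rfl fun k _ => ?_
    rw [← Matrix.mulVec_mulVec, ← Matrix.mulVec_mulVec, h.dotProduct_mulVec]
    rfl
  rw [e, ← Finset.sum_product']
  refine (Real.sum_mul_le_sqrt_mul_sqrt _ _ _).trans ?_
  rw [Finset.sum_product' (f := fun k i => (A k *ᵥ u) i ^ 2),
    Finset.sum_product' (f := fun k i => (M *ᵥ (A k *ᵥ w)) i ^ 2)]
  have h1 : ∑ k, ∑ i, (M *ᵥ (A k *ᵥ w)) i ^ 2 ≤ ‖M‖ ^ 2 * (s * ∑ i, w i ^ 2) := by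
    refine (Finset.sum_le_sum fun k _ => sum_sq_mulVec_le M _).trans ?_
    rw [← Finset.mul_sum]
    exact mul_le_mul_of_nonneg_left (h.variance w) (sq_nonneg _)
  calc _ ≤ √(s * ∑ i, u i ^ 2) * √(‖M‖ ^ 2 * (s * ∑ i, w i ^ 2)) :=
        mul_le_mul (Real.sqrt_le_sqrt (h.variance u)) (Real.sqrt_le_sqrt h1) (Real.sqrt_nonneg _)
          (Real.sqrt_nonneg _)
    _ = _ := by
        rw [Real.sqrt_mul h.variance_nonneg, Real.sqrt_mul (sq_nonneg _),
          Real.sqrt_mul h.variance_nonneg, Real.sqrt_sq (norm_nonneg _)]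
        linear_combination (‖M‖ * √(∑ i, u i ^ 2) * √(∑ i, w i ^ 2)) *
          Real.mul_self_sqrt h.variance_nonneg

/-- The basic tensor estimate: contracting the index `k` costs the covariance bound `V` in one
factor and the variance bound `s` in the other. -/
lemma CoeffBound.sum_sq_tensor_le (h : CoeffBound A s V) (u : ι → ℝ) (P Q R : Matrix ι ι ℝ) :
    ∑ j, ∑ p, ∑ q, (∑ k, (P *ᵥ (A k *ᵥ u)) j * (Q * A k * R) p q) ^ 2 ≤
      ‖P‖ ^ 2 * ‖Q‖ ^ 2 * ‖R‖ ^ 2 * (s * V) * ∑ i, u i ^ 2 := by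
  have h1 : ∀ j, ∑ p, ∑ q, (∑ k, (P *ᵥ (A k *ᵥ u)) j * (Q * A k * R) p q) ^ 2 ≤
      ‖Q‖ ^ 2 * ‖R‖ ^ 2 * V * ∑ k, (P *ᵥ (A k *ᵥ u)) j ^ 2 := by
    intro j
    have e : ∑ p, ∑ q, (∑ k, (P *ᵥ (A k *ᵥ u)) j * (Q * A k * R) p q) ^ 2 =
        frobSq (Q * (∑ k, (P *ᵥ (A k *ᵥ u)) j • A k) * R) := by
      simp [frobSq, Matrix.mul_sum, Matrix.sum_mul, Matrix.sum_apply]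
    rw [e]
    calc _ ≤ ‖R‖ ^ 2 * (‖Q‖ ^ 2 * (V * ∑ k, (P *ᵥ (A k *ᵥ u)) j ^ 2)) := by
          refine (frobSq_mul_le_right _ _).trans ?_
          gcongr
          refine (frobSq_mul_le_left _ _).trans ?_
          gcongr
          exact h.covariance _
      _ = _ := by ring
  refine (Finset.sum_le_sum fun j _ => h1 j).trans ?_
  rw [← Finset.mul_sum, Finset.sum_comm]
  have h2 : ∑ k, ∑ j, (P *ᵥ (A k *ᵥ u)) j ^ 2 ≤ ‖P‖ ^ 2 * (s * ∑ i, u i ^ 2) := by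
    refine (Finset.sum_le_sum fun k _ => sum_sq_mulVec_le P _).trans ?_
    rw [← Finset.mul_sum]
    exact mul_le_mul_of_nonneg_left (h.variance u) (sq_nonneg _)
  have hV := h.covariance_nonneg
  calc _ ≤ ‖Q‖ ^ 2 * ‖R‖ ^ 2 * V * (‖P‖ ^ 2 * (s * ∑ i, u i ^ 2)) := by gcongr
    _ = _ := by ring

/-- A crossing pair of contractions gains the factor `s * V`, in the operator norm. -/
lemma CoeffBound.bilin_crossing_le (h : CoeffBound A s V) (B₁ B₂ B₃ : Matrix ι ι ℝ)
    (u w : ι → ℝ) :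
    |∑ k, ∑ l, u ⬝ᵥ (A k * B₁ * A l * B₂ * A k * B₃ * A l) *ᵥ w| ≤
      s * V * (‖B₁‖ * ‖B₂‖ * ‖B₃‖) * (√(∑ i, u i ^ 2) * √(∑ i, w i ^ 2)) := by
  -- the indices cut the word at `A k B₃ A l` and `B₁ A l B₂`; the two crossing contractions then
  -- sit in different factors of a Cauchy-Schwarz inequality
  set α : ι × ι × ι → ℝ := fun x =>
    ∑ k, ((1 : Matrix ι ι ℝ) *ᵥ (A k *ᵥ u)) x.1 *
      ((1 : Matrix ι ι ℝ) * A k * B₃) x.2.1 x.2.2 with hα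
  set β : ι × ι × ι → ℝ := fun x =>
    ∑ l, ((1 : Matrix ι ι ℝ) *ᵥ (A l *ᵥ w)) x.2.2 * (B₁ * A l * B₂) x.1 x.2.1 with hβ
  have e : ∑ k, ∑ l, u ⬝ᵥ (A k * B₁ * A l * B₂ * A k * B₃ * A l) *ᵥ w = ∑ x, α x * β x := by
    have e1 : ∀ k l, u ⬝ᵥ (A k * B₁ * A l * B₂ * A k * B₃ * A l) *ᵥ w =
        ∑ x : ι × ι × ι, ((A k *ᵥ u) x.1 * (A k * B₃) x.2.1 x.2.2) *
          ((A l *ᵥ w) x.2.2 * (B₁ * A l * B₂) x.1 x.2.1) := by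
      intro k l
      have : A k * B₁ * A l * B₂ * A k * B₃ * A l =
          A k * ((B₁ * A l * B₂) * ((A k * B₃) * A l)) := by simp only [Matrix.mul_assoc]
      rw [this, ← Matrix.mulVec_mulVec w (A k), ← Matrix.mulVec_mulVec w (B₁ * A l * B₂),
        ← Matrix.mulVec_mulVec w (A k * B₃),
        h.dotProduct_mulVec, Fintype.sum_prod_type]
      simp only [Fintype.sum_prod_type]
      simp only [dotProduct]
      refine Finset.sum_congr rfl fun i _ => ?_
      have hmv : ∀ (M : Matrix ι ι ℝ) (v : ι → ℝ) (i : ι), (M *ᵥ v) i = ∑ p, M i p * v p :=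
        fun _ _ _ => rfl
      rw [hmv (B₁ * A l * B₂), Finset.mul_sum]
      simp only [hmv (A k * B₃), Finset.mul_sum]
      refine Finset.sum_congr rfl fun p _ => Finset.sum_congr rfl fun q _ => ?_
      ring
    simp only [e1, hα, hβ, Finset.sum_mul_sum, Matrix.one_mulVec, Matrix.one_mul]
    calc _ = ∑ k, ∑ x : ι × ι × ι, ∑ l, ((A k *ᵥ u) x.1 * (A k * B₃) x.2.1 x.2.2) *
          ((A l *ᵥ w) x.2.2 * (B₁ * A l * B₂) x.1 x.2.1) :=
          Finset.sum_congr rfl fun k _ => Finset.sum_comm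
      _ = _ := Finset.sum_comm
  have h1 : ‖(1 : Matrix ι ι ℝ)‖ ^ 2 ≤ 1 := pow_le_one₀ (norm_nonneg _) matrix_norm_one_le
  have hs := h.variance_nonneg
  have hV := h.covariance_nonneg
  have hα2 : ∑ x, α x ^ 2 ≤ ‖B₃‖ ^ 2 * (s * V) * ∑ i, u i ^ 2 := by
    simp only [Fintype.sum_prod_type, hα]
    refine (h.sum_sq_tensor_le u 1 1 B₃).trans ?_
    have : 0 ≤ ∑ i, u i ^ 2 := Finset.sum_nonneg fun _ _ => sq_nonneg _
    calc _ ≤ 1 * 1 * ‖B₃‖ ^ 2 * (s * V) * ∑ i, u i ^ 2 := by gcongr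
      _ = _ := by ring
  have hβ2 : ∑ x, β x ^ 2 ≤ (‖B₁‖ * ‖B₂‖) ^ 2 * (s * V) * ∑ i, w i ^ 2 := by
    simp only [Fintype.sum_prod_type, hβ]
    have := h.sum_sq_tensor_le w 1 B₁ B₂
    have hc : ∀ f : ι → ι → ι → ℝ, ∑ p, ∑ q, ∑ r, f p q r = ∑ r, ∑ p, ∑ q, f p q r := by
      intro f
      calc _ = ∑ p, ∑ r, ∑ q, f p q r := Finset.sum_congr rfl fun _ _ => Finset.sum_comm
        _ = _ := Finset.sum_comm
    rw [hc]
    refine this.trans ?_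
    have : 0 ≤ ∑ i, w i ^ 2 := Finset.sum_nonneg fun _ _ => sq_nonneg _
    calc _ ≤ 1 * ‖B₁‖ ^ 2 * ‖B₂‖ ^ 2 * (s * V) * ∑ i, w i ^ 2 := by gcongr
      _ = _ := by ring
  rw [e]
  refine Real.abs_le_sqrt (Finset.sum_mul_sq_le_sq_mul_sq _ α β) |>.trans ?_
  rw [Real.sqrt_le_left (by positivity)]
  have hu : 0 ≤ ∑ i, u i ^ 2 := Finset.sum_nonneg fun _ _ => sq_nonneg _
  have hw : 0 ≤ ∑ i, w i ^ 2 := Finset.sum_nonneg fun _ _ => sq_nonneg _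
  calc _ ≤ (‖B₃‖ ^ 2 * (s * V) * ∑ i, u i ^ 2) * ((‖B₁‖ * ‖B₂‖) ^ 2 * (s * V) * ∑ i, w i ^ 2) :=
        mul_le_mul hα2 hβ2 (Finset.sum_nonneg fun _ _ => sq_nonneg _) (by positivity)
    _ = _ := by
        simp only [mul_pow, Real.sq_sqrt hu, Real.sq_sqrt hw]; ring

end MatrixBounds

/-! ### Powers of symmetric matrices -/

section Spectral

variable {ι κ : Type*} [Fintype ι] [DecidableEq ι] [Fintype κ]

/-- Spectral theorem for real symmetric matrices, in the form used for powers. -/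
lemma exists_orthogonal_diagonalization {X : Matrix ι ι ℝ} (hX : Xᵀ = X) :
    ∃ (U : Matrix ι ι ℝ) (t : ι → ℝ), Uᵀ * U = 1 ∧
      ∀ a : ℕ, X ^ a = U * Matrix.diagonal (fun i => t i ^ a) * Uᵀ := by
  have hH : X.IsHermitian := by
    rw [Matrix.IsHermitian, Matrix.conjTranspose_eq_transpose_of_trivial, hX]
  set U : Matrix ι ι ℝ := hH.eigenvectorUnitary.1 with hU
  have h1 : Uᵀ * U = 1 := by
    have := Unitary.coe_star_mul_self hH.eigenvectorUnitary
    rwa [Matrix.star_eq_conjTranspose, Matrix.conjTranspose_eq_transpose_of_trivial] at this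
  have h2 : U * Uᵀ = 1 := mul_eq_one_comm.1 h1
  have h3 : X = U * Matrix.diagonal hH.eigenvalues * Uᵀ := by
    have := hH.spectral_theorem
    rw [Unitary.conjStarAlgAut_apply, Matrix.star_eq_conjTranspose,
      Matrix.conjTranspose_eq_transpose_of_trivial] at this
    exact this
  clear_value U
  generalize hH.eigenvalues = t at h3
  refine ⟨U, t, h1, fun a => ?_⟩
  induction a with
  | zero => simp [h2]
  | succ a ih =>
    rw [pow_succ, ih]
    conv_lhs => rw [h3]
    have : (Matrix.diagonal fun i => t i ^ (a + 1)) =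
        (Matrix.diagonal fun i => t i ^ a) * Matrix.diagonal t := by
      rw [Matrix.diagonal_mul_diagonal]; simp only [pow_succ]
    rw [this]
    calc _ = U * (Matrix.diagonal fun i => t i ^ a) * (Uᵀ * U) *
          Matrix.diagonal t * Uᵀ := by simp only [Matrix.mul_assoc]
      _ = _ := by rw [h1]; simp only [Matrix.mul_assoc, Matrix.one_mul]

lemma trace_orthogonal_conj {U : Matrix ι ι ℝ} (h : Uᵀ * U = 1) (t : ι → ℝ) :
    (U * Matrix.diagonal t * Uᵀ).trace = ∑ i, t i := by
  rw [Matrix.trace_mul_comm, ← Matrix.mul_assoc, h, Matrix.one_mul, Matrix.trace_diagonal]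

lemma matrix_norm_le_one_of_orthogonal {U : Matrix ι ι ℝ} (h : Uᵀ * U = 1) : ‖U‖ ≤ 1 := by
  have h2 := Matrix.l2_opNorm_conjTranspose_mul_self U
  rw [Matrix.conjTranspose_eq_transpose_of_trivial, h] at h2
  have := matrix_norm_one_le (ι := ι)
  nlinarith [norm_nonneg U]

lemma even_pow_le_one_add {N b : ℕ} (hN : Even N) (hb : b ≤ N) (x : ℝ) :
    |x| ^ b ≤ 1 + x ^ N := by
  rw [← hN.pow_abs x]
  rcases le_total |x| 1 with h | h
  · have := pow_le_one₀ (n := b) (abs_nonneg x) h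
    have : 0 ≤ |x| ^ N := by positivity
    linarith
  · have := pow_le_pow_right₀ h hb
    linarith

/-- A crude form of the weighted arithmetic-geometric mean inequality, which replaces Hölder's
inequality for Schatten norms below. -/
lemma mul_pow_le_sum_pow {N a b c e : ℕ} (hN : Even N) (h : a + b + c + e ≤ N) (x y z w : ℝ) :
    |x| ^ a * |y| ^ b * |z| ^ c * |w| ^ e ≤ 1 + x ^ N + y ^ N + z ^ N + w ^ N := by
  set M := max (max |x| |y|) (max |z| |w|) with hM
  have hM0 : 0 ≤ M := (abs_nonneg x).trans ((le_max_left _ _).trans (le_max_left _ _))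
  have h1 : |x| ^ a * |y| ^ b * |z| ^ c * |w| ^ e ≤ M ^ (a + b + c + e) := by
    rw [pow_add, pow_add, pow_add]
    gcongr
    · exact (le_max_left _ _).trans (le_max_left _ _)
    · exact (le_max_right _ _).trans (le_max_left _ _)
    · exact (le_max_left _ _).trans (le_max_right _ _)
    · exact (le_max_right _ _).trans (le_max_right _ _)
  have h2 := even_pow_le_one_add hN h M
  rw [abs_of_nonneg hM0] at h2
  have hx := hN.pow_nonneg x
  have hy := hN.pow_nonneg y
  have hz := hN.pow_nonneg z
  have hw := hN.pow_nonneg w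
  have h3 : M ^ N ≤ x ^ N + y ^ N + z ^ N + w ^ N := by
    rw [hM]
    rcases max_choice (max |x| |y|) (max |z| |w|) with h | h <;> rw [h]
    · rcases max_choice |x| |y| with h | h <;> rw [h, hN.pow_abs] <;> linarith
    · rcases max_choice |z| |w| with h | h <;> rw [h, hN.pow_abs] <;> linarith
  linarith

/-- For symmetric `X` and even `N`, `‖X‖ ^ N ≤ Tr (X ^ N)`. -/
lemma norm_pow_le_trace_pow [Nonempty ι] {X : Matrix ι ι ℝ} (hX : Xᵀ = X) {N : ℕ} (hN : Even N) :
    ‖X‖ ^ N ≤ (X ^ N).trace := by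
  obtain ⟨U, t, h1, h3⟩ := exists_orthogonal_diagonalization hX
  rw [h3 N, trace_orthogonal_conj h1]
  have hU := matrix_norm_le_one_of_orthogonal h1
  have hX1 : ‖X‖ ≤ ‖t‖ := by
    have h := h3 1
    simp only [pow_one] at h
    rw [h]
    calc _ ≤ ‖U‖ * ‖Matrix.diagonal t‖ * ‖Uᵀ‖ := by
          refine (Matrix.l2_opNorm_mul _ _).trans ?_
          gcongr
          exact Matrix.l2_opNorm_mul _ _
      _ ≤ 1 * ‖t‖ * 1 := by
          rw [matrix_norm_transpose, Matrix.l2_opNorm_diagonal]; gcongr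
      _ = _ := by ring
  obtain ⟨i, hi⟩ : ∃ i, ‖t‖ = |t i| := by
    obtain ⟨i, -, hi⟩ := Finset.exists_max_image Finset.univ (fun i => |t i|)
      Finset.univ_nonempty
    refine ⟨i, le_antisymm ?_ (norm_le_pi_norm t i)⟩
    exact (pi_norm_le_iff_of_nonneg (abs_nonneg _)).2 fun j => hi j (Finset.mem_univ j)
  calc ‖X‖ ^ N ≤ |t i| ^ N := by rw [← hi]; gcongr
    _ = t i ^ N := hN.pow_abs _
    _ ≤ _ := Finset.single_le_sum (f := fun i => t i ^ N) (fun i _ => hN.pow_nonneg _)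
      (Finset.mem_univ i)

lemma abs_trace_mul_pow_le (T : Matrix ι ι ℝ) {Y : Matrix ι ι ℝ} (hY : Yᵀ = Y) {N b : ℕ}
    (hN : Even N) (hb : b ≤ N) :
    |(T * Y ^ b).trace| ≤ ‖T‖ * (Fintype.card ι + (Y ^ N).trace) := by
  obtain ⟨U, t, h1, h3⟩ := exists_orthogonal_diagonalization hY
  have hU := matrix_norm_le_one_of_orthogonal h1
  have e : (T * Y ^ b).trace = ∑ i, (Uᵀ * T * U) i i * t i ^ b := by
    rw [h3 b, ← Matrix.mul_assoc, Matrix.trace_mul_comm, ← Matrix.mul_assoc, ← Matrix.mul_assoc]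
    simp [Matrix.trace, Matrix.mul_diagonal]
  have hent : ∀ i, |(Uᵀ * T * U) i i| ≤ ‖T‖ := by
    intro i
    have hn : ‖Uᵀ * T * U‖ ≤ ‖T‖ := by
      calc _ ≤ ‖Uᵀ‖ * ‖T‖ * ‖U‖ := by
            refine (Matrix.l2_opNorm_mul _ _).trans ?_
            gcongr
            exact Matrix.l2_opNorm_mul _ _
        _ ≤ 1 * ‖T‖ * 1 := by rw [matrix_norm_transpose]; gcongr
        _ = _ := by ring
    have h4 := sum_sq_mulVec_le (Uᵀ * T * U) (Pi.single i 1)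
    have h5 : ∑ j, (Pi.single i (1 : ℝ) : ι → ℝ) j ^ 2 = 1 := by
      simp [Pi.single_apply, ite_pow]
    rw [h5, mul_one] at h4
    have h6 : (Uᵀ * T * U) i i ^ 2 ≤ ‖Uᵀ * T * U‖ ^ 2 := by
      refine le_trans ?_ h4
      have := Finset.single_le_sum (f := fun j => ((Uᵀ * T * U) *ᵥ Pi.single i 1) j ^ 2)
        (fun j _ => sq_nonneg _) (Finset.mem_univ i)
      simpa using this
    exact (abs_le_of_sq_le_sq h6 (norm_nonneg _)).trans hn
  rw [e, h3 N, trace_orthogonal_conj h1]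
  calc _ ≤ ∑ i, |(Uᵀ * T * U) i i * t i ^ b| := Finset.abs_sum_le_sum_abs _ _
    _ ≤ ∑ i, ‖T‖ * (1 + t i ^ N) := by
        refine Finset.sum_le_sum fun i _ => ?_
        rw [abs_mul, abs_pow]
        exact mul_le_mul (hent i) (even_pow_le_one_add hN hb _) (by positivity) (norm_nonneg _)
    _ = _ := by
        rw [← Finset.mul_sum, Finset.sum_add_distrib]; simp

variable {A : κ → Matrix ι ι ℝ} {s V : ℝ}

lemma trace_covMap_mul_conj (A : κ → Matrix ι ι ℝ) (hA : ∀ k, (A k)ᵀ = A k) (U W : Matrix ι ι ℝ)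
    (t r : ι → ℝ) :
    (covMap A (U * Matrix.diagonal t * Uᵀ) * (W * Matrix.diagonal r * Wᵀ)).trace =
      ∑ k, ∑ i, ∑ j, (Wᵀ * A k * U) j i ^ 2 * (t i * r j) := by
  rw [covMap, Finset.sum_mul, Matrix.trace_sum]
  refine Finset.sum_congr rfl fun k _ => ?_
  have e1 : (A k * (U * Matrix.diagonal t * Uᵀ) * A k * (W * Matrix.diagonal r * Wᵀ)).trace =
      ((Wᵀ * A k * U) * Matrix.diagonal t * ((Uᵀ * A k * W) * Matrix.diagonal r)).trace := by
    rw [← Matrix.mul_assoc _ _ Wᵀ, Matrix.trace_mul_comm]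
    simp only [Matrix.mul_assoc]
  have e2 : Uᵀ * A k * W = (Wᵀ * A k * U)ᵀ := by
    simp only [Matrix.transpose_mul, Matrix.transpose_transpose, hA, Matrix.mul_assoc]
  rw [e1, e2, Matrix.trace, Finset.sum_comm]
  refine Finset.sum_congr rfl fun j _ => ?_
  rw [Matrix.diag_apply, Matrix.mul_apply]
  refine Finset.sum_congr rfl fun i _ => ?_
  rw [Matrix.mul_diagonal, Matrix.mul_diagonal, Matrix.transpose_apply]
  ring

/-- `a ↦ Tr (S(|X|^a) |Y|^(n-a))` is convex up to constants, hence controlled in the middle range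
by its values at two even exponents. -/
lemma abs_trace_covMap_pow_mul_pow_le (hA : ∀ k, (A k)ᵀ = A k) {X Y : Matrix ι ι ℝ}
    (hX : Xᵀ = X) (hY : Yᵀ = Y) {m a b c : ℕ} (hm : Even m) (hc : Even c)
    (hab : a + b = m + c) (ha : m ≤ a) (hb : m ≤ b) :
    |(covMap A (X ^ a) * Y ^ b).trace| ≤
      (covMap A (X ^ m) * Y ^ c).trace + (covMap A (X ^ c) * Y ^ m).trace := by
  obtain ⟨U, t, -, h3⟩ := exists_orthogonal_diagonalization hX
  obtain ⟨W, r, -, h4⟩ := exists_orthogonal_diagonalization hY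
  simp only [h3, h4, trace_covMap_mul_conj A hA, ← Finset.sum_add_distrib, ← mul_add]
  refine (Finset.abs_sum_le_sum_abs _ _).trans (Finset.sum_le_sum fun k _ => ?_)
  refine (Finset.abs_sum_le_sum_abs _ _).trans (Finset.sum_le_sum fun i _ => ?_)
  refine (Finset.abs_sum_le_sum_abs _ _).trans (Finset.sum_le_sum fun j _ => ?_)
  rw [abs_mul, abs_of_nonneg (sq_nonneg _)]
  refine mul_le_mul_of_nonneg_left ?_ (sq_nonneg _)
  rw [abs_mul, abs_pow, abs_pow, ← hm.pow_abs (t i), ← hm.pow_abs (r j), ← hc.pow_abs (t i),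
    ← hc.pow_abs (r j)]
  generalize |t i| = x, |r j| = y, abs_nonneg (t i) = hx, abs_nonneg (r j) = hy
  obtain ⟨a', rfl⟩ := Nat.exists_eq_add_of_le ha
  obtain ⟨b', rfl⟩ := Nat.exists_eq_add_of_le hb
  obtain rfl : c = m + (a' + b') := by omega
  have : x ^ a' * y ^ b' ≤ x ^ (a' + b') + y ^ (a' + b') := by
    rw [pow_add, pow_add]
    have := pow_nonneg hx a'
    have := pow_nonneg hy b'
    rcases le_total x y with h | h
    · have := pow_le_pow_left₀ hx h a'
      nlinarith [mul_nonneg (pow_nonneg hx a') (pow_nonneg hx b')]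
    · have := pow_le_pow_left₀ hy h b'
      nlinarith [mul_nonneg (pow_nonneg hy a') (pow_nonneg hy b')]
  calc x ^ (m + a') * y ^ (m + b') = (x ^ m * y ^ m) * (x ^ a' * y ^ b') := by ring
    _ ≤ (x ^ m * y ^ m) * (x ^ (a' + b') + y ^ (a' + b')) := by gcongr
    _ = _ := by ring

end Spectral

/-! ### Crossing contractions under the trace -/

section TraceCrossing

variable {ι κ : Type*} [Fintype ι] [DecidableEq ι] [Fintype κ]
variable {A : κ → Matrix ι ι ℝ} {s V : ℝ}

lemma CoeffBound.sum_sq_tensor_orthogonal_le (h : CoeffBound A s V) {P Q R T : Matrix ι ι ℝ}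
    (hP : ‖P‖ ≤ 1) (hQ : ‖Q‖ ≤ 1) (hR : ‖R‖ ≤ 1) (hT : ‖T‖ ≤ 1) (i : ι) :
    ∑ j, ∑ p, ∑ q, (∑ k, (P * A k * Q) i j * (R * A k * T) p q) ^ 2 ≤ s * V := by
  have e : ∀ k j, (P * A k * Q) i j = (Qᵀ *ᵥ (A k *ᵥ P i)) j := by
    intro k j
    have h1 : (P * A k * Q)ᵀ = Qᵀ * (A k * Pᵀ) := by
      rw [Matrix.transpose_mul, Matrix.transpose_mul, h.symm]
    rw [← Matrix.transpose_apply (P * A k * Q) j i, h1, Matrix.mulVec_mulVec, ← Matrix.mul_assoc,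
      Matrix.mul_apply]
    rfl
  simp only [e]
  refine (h.sum_sq_tensor_le (P i) Qᵀ R T).trans ?_
  have h1 : ∑ j, P i j ^ 2 ≤ 1 := by
    have h4 := sum_sq_mulVec_le Pᵀ (Pi.single i 1)
    have h5 : ∑ j, (Pi.single i (1 : ℝ) : ι → ℝ) j ^ 2 = 1 := by
      simp [Pi.single_apply, ite_pow]
    rw [h5, mul_one, matrix_norm_transpose] at h4
    simp only [Matrix.mulVec_single_one, Matrix.col_apply, Matrix.transpose_apply] at h4
    exact h4.trans (pow_le_one₀ (norm_nonneg _) hP)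
  have h0 : 0 ≤ ∑ j, P i j ^ 2 := Finset.sum_nonneg fun _ _ => sq_nonneg _
  have hsV := mul_nonneg h.variance_nonneg h.covariance_nonneg
  have hQ' : ‖Qᵀ‖ ^ 2 ≤ 1 := pow_le_one₀ (norm_nonneg _) (by rwa [matrix_norm_transpose])
  have hR' : ‖R‖ ^ 2 ≤ 1 := pow_le_one₀ (norm_nonneg _) hR
  have hT' : ‖T‖ ^ 2 ≤ 1 := pow_le_one₀ (norm_nonneg _) hT
  calc _ ≤ 1 * 1 * 1 * (s * V) * 1 := by gcongr
    _ = _ := by ring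

/-- A weighted form of the previous bound: a weight depending on any one of the four indices can
be summed separately. -/
lemma CoeffBound.sum_sq_tensor_weighted_le (h : CoeffBound A s V) {P Q R T : Matrix ι ι ℝ}
    (hP : ‖P‖ ≤ 1) (hQ : ‖Q‖ ≤ 1) (hR : ‖R‖ ≤ 1) (hT : ‖T‖ ≤ 1) {f g r t : ι → ℝ}
    (hf : ∀ i, 0 ≤ f i) (hg : ∀ i, 0 ≤ g i) (hr : ∀ i, 0 ≤ r i) (ht : ∀ i, 0 ≤ t i) :
    ∑ i, ∑ j, ∑ p, ∑ q, (∑ k, (P * A k * Q) i j * (R * A k * T) p q) ^ 2 *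
        (1 + f i + g j + r p + t q) ≤
      s * V * (Fintype.card ι + ∑ i, f i + ∑ i, g i + ∑ i, r i + ∑ i, t i) := by
  set γ : ι → ι → ι → ι → ℝ :=
    fun i j p q => (∑ k, (P * A k * Q) i j * (R * A k * T) p q) ^ 2 with hγ
  have tr : ∀ (P Q : Matrix ι ι ℝ) (k : κ) (i j : ι),
      (P * A k * Q) i j = (Qᵀ * A k * Pᵀ) j i := by
    intro P Q k i j
    rw [← Matrix.transpose_apply (P * A k * Q) j i, Matrix.transpose_mul, Matrix.transpose_mul,
      h.symm, ← Matrix.mul_assoc]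
  have hP' : ‖Pᵀ‖ ≤ 1 := by rwa [matrix_norm_transpose]
  have hQ' : ‖Qᵀ‖ ≤ 1 := by rwa [matrix_norm_transpose]
  have hR' : ‖Rᵀ‖ ≤ 1 := by rwa [matrix_norm_transpose]
  have hT' : ‖Tᵀ‖ ≤ 1 := by rwa [matrix_norm_transpose]
  have b1 : ∀ i, ∑ j, ∑ p, ∑ q, γ i j p q ≤ s * V := fun i =>
    h.sum_sq_tensor_orthogonal_le hP hQ hR hT i
  have b2 : ∀ j, ∑ i, ∑ p, ∑ q, γ i j p q ≤ s * V := fun j => by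
    simp only [hγ, tr P Q]
    exact h.sum_sq_tensor_orthogonal_le hQ' hP' hR hT j
  have b3 : ∀ p, ∑ q, ∑ i, ∑ j, γ i j p q ≤ s * V := fun p => by
    simp only [hγ, mul_comm ((P * A _ * Q) _ _)]
    exact h.sum_sq_tensor_orthogonal_le hR hT hP hQ p
  have b4 : ∀ q, ∑ p, ∑ i, ∑ j, γ i j p q ≤ s * V := fun q => by
    simp only [hγ, mul_comm ((P * A _ * Q) _ _), tr R T]
    exact h.sum_sq_tensor_orthogonal_le hT' hR' hP hQ q
  have key : ∀ (F : ι → ℝ) (hF : ∀ i, 0 ≤ F i) (S : ι → ℝ), (∀ i, S i ≤ s * V) →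
      ∑ i, F i * S i ≤ s * V * ∑ i, F i := by
    intro F hF S hS
    rw [Finset.mul_sum]
    exact Finset.sum_le_sum fun i _ => by
      rw [mul_comm]; exact mul_le_mul_of_nonneg_right (hS i) (hF i)
  have c0 := key 1 (fun _ => zero_le_one) _ b1
  have c1 := key f hf _ b1
  have c2 := key g hg _ b2
  have c3 := key r hr _ b3
  have c4 := key t ht _ b4
  simp only [Finset.mul_sum] at c0 c1 c2 c3 c4
  have d2 : ∑ i, ∑ j, ∑ p, ∑ q, g j * γ i j p q = ∑ j, ∑ i, ∑ p, ∑ q, g j * γ i j p q :=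
    Finset.sum_comm
  have swap : ∀ (F : ι → ι → ι → ι → ℝ), ∑ i, ∑ j, ∑ p, ∑ q, F i j p q =
      ∑ p, ∑ q, ∑ i, ∑ j, F i j p q := by
    intro F
    calc _ = ∑ i, ∑ p, ∑ j, ∑ q, F i j p q := Finset.sum_congr rfl fun _ _ => Finset.sum_comm
      _ = ∑ p, ∑ i, ∑ j, ∑ q, F i j p q := Finset.sum_comm
      _ = ∑ p, ∑ i, ∑ q, ∑ j, F i j p q := Finset.sum_congr rfl fun _ _ =>
          Finset.sum_congr rfl fun _ _ => Finset.sum_comm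
      _ = _ := Finset.sum_congr rfl fun _ _ => Finset.sum_comm
  have d3 : ∑ i, ∑ j, ∑ p, ∑ q, r p * γ i j p q = ∑ p, ∑ q, ∑ i, ∑ j, r p * γ i j p q :=
    swap _
  have d4 : ∑ i, ∑ j, ∑ p, ∑ q, t q * γ i j p q = ∑ q, ∑ p, ∑ i, ∑ j, t q * γ i j p q := by
    rw [swap, Finset.sum_comm]
  rw [← d2] at c2
  rw [← d3] at c3
  rw [← d4] at c4
  have e : ∑ i, ∑ j, ∑ p, ∑ q, γ i j p q * (1 + f i + g j + r p + t q) =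
      ∑ i, ∑ j, ∑ p, ∑ q, (1 : ι → ℝ) i * γ i j p q + ∑ i, ∑ j, ∑ p, ∑ q, f i * γ i j p q +
      ∑ i, ∑ j, ∑ p, ∑ q, g j * γ i j p q + ∑ i, ∑ j, ∑ p, ∑ q, r p * γ i j p q +
      ∑ i, ∑ j, ∑ p, ∑ q, t q * γ i j p q := by
    simp only [← Finset.sum_add_distrib]
    refine Finset.sum_congr rfl fun i _ => Finset.sum_congr rfl fun j _ =>
      Finset.sum_congr rfl fun p _ => Finset.sum_congr rfl fun q _ => ?_
    simp only [Pi.one_apply]; ring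
  rw [e]
  simp only [mul_add, Finset.mul_sum]
  have c0' : ∑ i, s * V * (1 : ι → ℝ) i = s * V * Fintype.card ι := by
    rw [← Finset.mul_sum]; simp
  rw [c0'] at c0
  linarith

lemma trace_mul_diagonal_four (B₁ B₂ B₃ B₄ : Matrix ι ι ℝ) (t₁ t₂ t₃ t₄ : ι → ℝ) :
    (B₁ * Matrix.diagonal t₁ * (B₂ * Matrix.diagonal t₂) * (B₃ * Matrix.diagonal t₃) *
      (B₄ * Matrix.diagonal t₄)).trace =
      ∑ i, ∑ j, ∑ p, ∑ q, (B₁ q i * B₃ j p) * (B₂ i j * B₄ p q) * (t₁ i * t₂ j * t₃ p * t₄ q) := by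
  rw [Matrix.mul_assoc (B₁ * Matrix.diagonal t₁), Matrix.mul_assoc (B₁ * Matrix.diagonal t₁),
    Matrix.mul_assoc (B₂ * Matrix.diagonal t₂)]
  rw [Matrix.trace]
  simp only [Matrix.diag_apply, Matrix.mul_apply (M := B₁ * Matrix.diagonal t₁),
    Matrix.mul_apply (M := B₂ * Matrix.diagonal t₂),
    Matrix.mul_apply (M := B₃ * Matrix.diagonal t₃), Matrix.mul_diagonal,
    Finset.mul_sum]
  calc _ = ∑ i, ∑ q, ∑ j, ∑ p, (B₁ q i * t₁ i) * ((B₂ i j * t₂ j) * ((B₃ j p * t₃ p) *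
        (B₄ p q * t₄ q))) := Finset.sum_comm
    _ = ∑ i, ∑ j, ∑ q, ∑ p, (B₁ q i * t₁ i) * ((B₂ i j * t₂ j) * ((B₃ j p * t₃ p) *
        (B₄ p q * t₄ q))) := Finset.sum_congr rfl fun _ _ => Finset.sum_comm
    _ = ∑ i, ∑ j, ∑ p, ∑ q, (B₁ q i * t₁ i) * ((B₂ i j * t₂ j) * ((B₃ j p * t₃ p) *
        (B₄ p q * t₄ q))) := Finset.sum_congr rfl fun _ _ => Finset.sum_congr rfl fun _ _ =>
          Finset.sum_comm
    _ = _ := by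
        refine Finset.sum_congr rfl fun i _ => Finset.sum_congr rfl fun j _ =>
          Finset.sum_congr rfl fun p _ => Finset.sum_congr rfl fun q _ => ?_
        ring

/-- A crossing pair of contractions gains the factor `s * V`, for the trace of a word in powers of
two symmetric matrices. In eigenbases of `X` and `Y` this is Cauchy-Schwarz. -/
lemma CoeffBound.abs_trace_crossing_le (h : CoeffBound A s V) {X Y : Matrix ι ι ℝ}
    (hX : Xᵀ = X) (hY : Yᵀ = Y) {N a b c e : ℕ} (hN : Even N) (habce : a + b + c + e ≤ N) :
    |∑ k, ∑ l, (A k * X ^ a * A l * X ^ b * A k * Y ^ c * A l * Y ^ e).trace| ≤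
      s * V * (Fintype.card ι + 2 * (X ^ N).trace + 2 * (Y ^ N).trace) := by
  obtain ⟨U, x, hU1, hx⟩ := exists_orthogonal_diagonalization hX
  obtain ⟨W, y, hW1, hy⟩ := exists_orthogonal_diagonalization hY
  have hU := matrix_norm_le_one_of_orthogonal hU1
  have hW := matrix_norm_le_one_of_orthogonal hW1
  have hU' : ‖Uᵀ‖ ≤ 1 := by rwa [matrix_norm_transpose]
  have hW' : ‖Wᵀ‖ ≤ 1 := by rwa [matrix_norm_transpose]
  set α : ι → ι → ι → ι → ℝ :=
    fun q i j p => ∑ k, (Wᵀ * A k * U) q i * (Uᵀ * A k * W) j p with hα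
  set β : ι → ι → ι → ι → ℝ :=
    fun i j p q => ∑ l, (Uᵀ * A l * U) i j * (Wᵀ * A l * W) p q with hβ
  have e1 : ∀ k l, (A k * X ^ a * A l * X ^ b * A k * Y ^ c * A l * Y ^ e).trace =
      ∑ i, ∑ j, ∑ p, ∑ q, ((Wᵀ * A k * U) q i * (Uᵀ * A k * W) j p) *
        ((Uᵀ * A l * U) i j * (Wᵀ * A l * W) p q) * (x i ^ a * x j ^ b * y p ^ c * y q ^ e) := by
    intro k l
    rw [← trace_mul_diagonal_four, hx, hx, hy, hy, ← Matrix.mul_assoc _ _ Wᵀ,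
      Matrix.trace_mul_comm]
    simp only [Matrix.mul_assoc]
  have e2 : ∑ k, ∑ l, (A k * X ^ a * A l * X ^ b * A k * Y ^ c * A l * Y ^ e).trace =
      ∑ i, ∑ j, ∑ p, ∑ q, α q i j p * β i j p q * (x i ^ a * x j ^ b * y p ^ c * y q ^ e) := by
    have sw : ∀ {τ : Type _} [Fintype τ] (F : τ → ι → ι → ι → ι → ℝ),
        ∑ k, ∑ i, ∑ j, ∑ p, ∑ q, F k i j p q = ∑ i, ∑ j, ∑ p, ∑ q, ∑ k, F k i j p q := by
      intro τ _ F
      rw [Finset.sum_comm]; refine Finset.sum_congr rfl fun _ _ => ?_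
      rw [Finset.sum_comm]; refine Finset.sum_congr rfl fun _ _ => ?_
      rw [Finset.sum_comm]; refine Finset.sum_congr rfl fun _ _ => ?_
      rw [Finset.sum_comm]
    set f : κ → κ → ι → ι → ι → ι → ℝ := fun k l i j p q =>
      ((Wᵀ * A k * U) q i * (Uᵀ * A k * W) j p) * ((Uᵀ * A l * U) i j * (Wᵀ * A l * W) p q) *
        (x i ^ a * x j ^ b * y p ^ c * y q ^ e) with hf
    calc _ = ∑ k, ∑ l, ∑ i, ∑ j, ∑ p, ∑ q, f k l i j p q :=
          Finset.sum_congr rfl fun k _ => Finset.sum_congr rfl fun l _ => e1 k l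
      _ = ∑ k, ∑ i, ∑ j, ∑ p, ∑ q, ∑ l, f k l i j p q :=
          Finset.sum_congr rfl fun k _ => sw (f k)
      _ = ∑ i, ∑ j, ∑ p, ∑ q, ∑ k, ∑ l, f k l i j p q :=
          sw fun k i j p q => ∑ l, f k l i j p q
      _ = _ := by
          refine Finset.sum_congr rfl fun i _ => Finset.sum_congr rfl fun j _ =>
            Finset.sum_congr rfl fun p _ => Finset.sum_congr rfl fun q _ => ?_
          simp only [hf, hα, hβ, ← Finset.sum_mul, ← Finset.sum_mul_sum]
  have hαw := h.sum_sq_tensor_weighted_le hW' hU hU' hW (f := fun q => y q ^ N)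
    (g := fun i => x i ^ N) (r := fun j => x j ^ N) (t := fun p => y p ^ N)
    (fun _ => hN.pow_nonneg _) (fun _ => hN.pow_nonneg _) (fun _ => hN.pow_nonneg _)
    (fun _ => hN.pow_nonneg _)
  have hβw := h.sum_sq_tensor_weighted_le hU' hU hW' hW (f := fun q => x q ^ N)
    (g := fun i => x i ^ N) (r := fun j => y j ^ N) (t := fun p => y p ^ N)
    (fun _ => hN.pow_nonneg _) (fun _ => hN.pow_nonneg _) (fun _ => hN.pow_nonneg _)
    (fun _ => hN.pow_nonneg _)
  have rot : ∀ F : ι → ι → ι → ι → ℝ, ∑ q, ∑ i, ∑ j, ∑ p, F q i j p =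
      ∑ i, ∑ j, ∑ p, ∑ q, F q i j p := by
    intro F
    rw [Finset.sum_comm]; refine Finset.sum_congr rfl fun _ _ => ?_
    rw [Finset.sum_comm]; refine Finset.sum_congr rfl fun _ _ => ?_
    rw [Finset.sum_comm]
  rw [rot] at hαw
  rw [e2, hx N, hy N, trace_orthogonal_conj hU1, trace_orthogonal_conj hW1]
  have main : ∀ i j p q, |α q i j p * β i j p q * (x i ^ a * x j ^ b * y p ^ c * y q ^ e)| ≤
      (1 / 2) * (α q i j p ^ 2 * (1 + y q ^ N + x i ^ N + x j ^ N + y p ^ N)) +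
      (1 / 2) * (β i j p q ^ 2 * (1 + x i ^ N + x j ^ N + y p ^ N + y q ^ N)) := by
    intro i j p q
    have h1 := mul_pow_le_sum_pow hN habce (x i) (x j) (y p) (y q)
    have h2 : |α q i j p * β i j p q| ≤ (α q i j p ^ 2 + β i j p q ^ 2) / 2 := by
      rw [abs_mul]
      nlinarith [sq_nonneg (|α q i j p| - |β i j p q|), sq_abs (α q i j p), sq_abs (β i j p q)]
    rw [abs_mul, abs_mul _ (y q ^ e), abs_mul _ (y p ^ c), abs_mul (x i ^ a), abs_pow, abs_pow,
      abs_pow, abs_pow]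
    calc _ ≤ (α q i j p ^ 2 + β i j p q ^ 2) / 2 *
          (1 + x i ^ N + x j ^ N + y p ^ N + y q ^ N) :=
          mul_le_mul h2 h1 (by positivity) (by positivity)
      _ = _ := by ring
  calc _ ≤ ∑ i, ∑ j, ∑ p, ∑ q, |α q i j p * β i j p q * (x i ^ a * x j ^ b * y p ^ c * y q ^ e)| :=
        (Finset.abs_sum_le_sum_abs _ _).trans <| Finset.sum_le_sum fun _ _ =>
        (Finset.abs_sum_le_sum_abs _ _).trans <| Finset.sum_le_sum fun _ _ =>
        (Finset.abs_sum_le_sum_abs _ _).trans <| Finset.sum_le_sum fun _ _ =>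
        Finset.abs_sum_le_sum_abs _ _
    _ ≤ _ := Finset.sum_le_sum fun i _ => Finset.sum_le_sum fun j _ =>
        Finset.sum_le_sum fun p _ => Finset.sum_le_sum fun q _ => main i j p q
    _ ≤ _ := by
        simp only [Finset.sum_add_distrib, ← Finset.mul_sum]
        linarith

end TraceCrossing

/-! ### Gaussian series as matrices of polynomials -/

section MatrixPolynomial

variable {ι κ : Type*} [Fintype ι] [DecidableEq ι] [Fintype κ]

/-- A constant matrix, regarded as a matrix of polynomials. -/
noncomputable def constPoly (κ : Type*) (B : Matrix ι ι ℝ) : Matrix ι ι (MvPolynomial κ ℝ) :=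
  MvPolynomial.C.mapMatrix B

/-- The Gaussian series `∑ x k A k` as a matrix of polynomials in the variables `x k`. -/
noncomputable def seriesPoly (A : κ → Matrix ι ι ℝ) : Matrix ι ι (MvPolynomial κ ℝ) :=
  ∑ k, (MvPolynomial.X k : MvPolynomial κ ℝ) • constPoly κ (A k)

/-- The map `M ↦ ∑ A k M A k` on matrices of polynomials. -/
noncomputable def covMapPoly (A : κ → Matrix ι ι ℝ) (M : Matrix ι ι (MvPolynomial κ ℝ)) :
    Matrix ι ι (MvPolynomial κ ℝ) :=
  ∑ k, constPoly κ (A k) * M * constPoly κ (A k)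

/-- The entrywise expectation of a matrix of polynomials in independent standard Gaussians. -/
noncomputable def matrixE (M : Matrix ι ι (MvPolynomial κ ℝ)) : Matrix ι ι ℝ :=
  Matrix.of fun i j => gaussianE (M i j)

/-- The entrywise partial derivative. -/
noncomputable def matrixDeriv (l : κ) (M : Matrix ι ι (MvPolynomial κ ℝ)) :
    Matrix ι ι (MvPolynomial κ ℝ) :=
  M.map (MvPolynomial.pderiv l)

omit [DecidableEq ι] in
lemma trace_matrixE (M : Matrix ι ι (MvPolynomial κ ℝ)) :
    (matrixE M).trace = gaussianE M.trace := by
  simp [matrixE, Matrix.trace]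

omit [Fintype ι] [DecidableEq ι] in
lemma matrixE_sum {τ : Type*} (t : Finset τ) (M : τ → Matrix ι ι (MvPolynomial κ ℝ)) :
    matrixE (∑ k ∈ t, M k) = ∑ k ∈ t, matrixE (M k) := by
  ext i j; simp [matrixE, Matrix.sum_apply]

lemma matrixE_constPoly_mul (B : Matrix ι ι ℝ) (M : Matrix ι ι (MvPolynomial κ ℝ)) :
    matrixE (constPoly κ B * M) = B * matrixE M := by
  ext i j; simp [matrixE, constPoly, Matrix.mul_apply, gaussianE_C_mul]

lemma matrixE_mul_constPoly (B : Matrix ι ι ℝ) (M : Matrix ι ι (MvPolynomial κ ℝ)) :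
    matrixE (M * constPoly κ B) = matrixE M * B := by
  ext i j
  simp only [matrixE, Matrix.of_apply, Matrix.mul_apply, map_sum]
  refine Finset.sum_congr rfl fun p _ => ?_
  rw [mul_comm, mul_comm (gaussianE _)]
  exact gaussianE_C_mul _ _

omit [Fintype ι] in
lemma matrixE_one : matrixE (1 : Matrix ι ι (MvPolynomial κ ℝ)) = 1 := by
  ext i j
  by_cases hij : i = j
  · subst hij
    have : gaussianE (1 : MvPolynomial κ ℝ) = 1 := gaussianE_C 1
    simp [matrixE, this]
  · simp [matrixE, hij]

lemma matrixE_covMapPoly (A : κ → Matrix ι ι ℝ) (M : Matrix ι ι (MvPolynomial κ ℝ)) :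
    matrixE (covMapPoly A M) = covMap A (matrixE M) := by
  simp [covMapPoly, covMap, matrixE_sum, matrixE_mul_constPoly, matrixE_constPoly_mul]

omit [DecidableEq ι] [Fintype κ] in
lemma matrixDeriv_mul (l : κ) (M M' : Matrix ι ι (MvPolynomial κ ℝ)) :
    matrixDeriv l (M * M') = matrixDeriv l M * M' + M * matrixDeriv l M' := by
  ext1 i j
  simp [matrixDeriv, Matrix.mul_apply, Finset.sum_add_distrib]
  rw [add_comm]
  congr 1
  exact Finset.sum_congr rfl fun _ _ => mul_comm _ _

omit [Fintype ι] [DecidableEq ι] [Fintype κ] in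
lemma matrixDeriv_sum {τ : Type*} (t : Finset τ) (l : κ)
    (M : τ → Matrix ι ι (MvPolynomial κ ℝ)) :
    matrixDeriv l (∑ k ∈ t, M k) = ∑ k ∈ t, matrixDeriv l (M k) := by
  ext1 i j; simp [matrixDeriv, Matrix.sum_apply]

omit [Fintype κ] in
lemma matrixDeriv_constPoly (l : κ) (B : Matrix ι ι ℝ) :
    matrixDeriv l (constPoly κ B) = 0 := by
  ext1 i j; simp [matrixDeriv, constPoly]

lemma matrixDeriv_covMapPoly (A : κ → Matrix ι ι ℝ) (l : κ)
    (M : Matrix ι ι (MvPolynomial κ ℝ)) :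
    matrixDeriv l (covMapPoly A M) = covMapPoly A (matrixDeriv l M) := by
  simp [covMapPoly, matrixDeriv_sum, matrixDeriv_mul, matrixDeriv_constPoly]

lemma matrixDeriv_seriesPoly (A : κ → Matrix ι ι ℝ) (l : κ) :
    matrixDeriv l (seriesPoly A) = constPoly κ (A l) := by
  classical
  ext1 i j
  simp [matrixDeriv, seriesPoly, constPoly, Matrix.sum_apply, MvPolynomial.pderiv_X,
    Pi.single_apply]

lemma matrixDeriv_seriesPoly_pow (A : κ → Matrix ι ι ℝ) (l : κ) (a : ℕ) :
    matrixDeriv l (seriesPoly A ^ a) = ∑ c ∈ Finset.range a,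
      seriesPoly A ^ c * constPoly κ (A l) * seriesPoly A ^ (a - 1 - c) := by
  induction a with
  | zero =>
    ext1 i j
    by_cases hij : i = j <;> simp [matrixDeriv, hij]
  | succ a ih =>
    rw [pow_succ, matrixDeriv_mul, ih, matrixDeriv_seriesPoly, Finset.sum_range_succ,
      Finset.sum_mul]
    refine congrArg₂ (· + ·) ?_ ?_
    · refine Finset.sum_congr rfl fun c hc => ?_
      have hc := Finset.mem_range.1 hc
      have h : a + 1 - 1 - c = a - 1 - c + 1 := by omega
      rw [h, pow_succ, ← Matrix.mul_assoc]
    · simp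

/-- Evaluation of the polynomial Gaussian series at a point. -/
lemma map_eval_seriesPoly (A : κ → Matrix ι ι ℝ) (x : κ → ℝ) :
    (MvPolynomial.eval x).mapMatrix (seriesPoly A) = ∑ k, x k • A k := by
  ext i j; simp [seriesPoly, constPoly, Matrix.sum_apply]

omit [Fintype κ] in
lemma map_eval_constPoly (B : Matrix ι ι ℝ) (x : κ → ℝ) :
    (MvPolynomial.eval x).mapMatrix (constPoly κ B) = B := by
  ext i j; simp [constPoly]

lemma map_eval_covMapPoly (A : κ → Matrix ι ι ℝ) (x : κ → ℝ)
    (M : Matrix ι ι (MvPolynomial κ ℝ)) :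
    (MvPolynomial.eval x).mapMatrix (covMapPoly A M) =
      covMap A ((MvPolynomial.eval x).mapMatrix M) := by
  simp only [covMapPoly, map_sum, map_mul, map_eval_constPoly, covMap]

omit [Fintype κ] in
lemma eval_trace (x : κ → ℝ) (M : Matrix ι ι (MvPolynomial κ ℝ)) :
    MvPolynomial.eval x M.trace = ((MvPolynomial.eval x).mapMatrix M).trace := by
  simp [Matrix.trace]

variable {A : κ → Matrix ι ι ℝ} {s V : ℝ}

omit [DecidableEq ι] in
lemma CoeffBound.transpose_series (h : CoeffBound A s V) (x : κ → ℝ) :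
    (∑ k, x k • A k)ᵀ = ∑ k, x k • A k := by
  simp [Matrix.transpose_sum, h.symm]

/-- The Schwinger-Dyson equation: integration by parts in one factor of a power of the Gaussian
series. -/
lemma matrixE_seriesPoly_pow_succ (A : κ → Matrix ι ι ℝ) (q : ℕ) :
    matrixE (seriesPoly A ^ (q + 1)) = ∑ c ∈ Finset.range q,
      matrixE (covMapPoly A (seriesPoly A ^ c) * seriesPoly A ^ (q - 1 - c)) := by
  have h1 : ∀ k, matrixE ((MvPolynomial.X k : MvPolynomial κ ℝ) •
      (constPoly κ (A k) * seriesPoly A ^ q)) =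
      matrixE (constPoly κ (A k) * matrixDeriv k (seriesPoly A ^ q)) := by
    intro k
    have : matrixDeriv k (constPoly κ (A k) * seriesPoly A ^ q) =
        constPoly κ (A k) * matrixDeriv k (seriesPoly A ^ q) := by
      rw [matrixDeriv_mul, matrixDeriv_constPoly, Matrix.zero_mul, zero_add]
    rw [← this]
    ext i j
    simp only [matrixE, matrixDeriv, Matrix.of_apply, Matrix.smul_apply, smul_eq_mul,
      gaussianE_X_mul, Matrix.map_apply]
  have h2 : seriesPoly A ^ (q + 1) = ∑ k, (MvPolynomial.X k : MvPolynomial κ ℝ) •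
      (constPoly κ (A k) * seriesPoly A ^ q) := by
    rw [pow_succ']
    conv_lhs => enter [1]; rw [seriesPoly]
    simp [Finset.sum_mul]
  rw [h2, matrixE_sum]
  simp only [h1, matrixDeriv_seriesPoly_pow, Finset.mul_sum, matrixE_sum]
  rw [Finset.sum_comm]
  refine Finset.sum_congr rfl fun c _ => ?_
  rw [← matrixE_sum, covMapPoly, Finset.sum_mul]
  simp only [Matrix.mul_assoc]

omit [DecidableEq ι] in
lemma trace_mul_eq_sum {R : Type*} [CommSemiring R] (M M' : Matrix ι ι R) :
    (M * M').trace = ∑ x : ι × ι, M x.1 x.2 * M' x.2 x.1 := by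
  rw [Fintype.sum_prod_type]; rfl

/-- Decoupling of the two factors in the Schwinger-Dyson equation. By Gaussian interpolation, the
error is controlled by words with a crossing pair of contractions. If `a` or `b` is zero there are
no such words, and the truncated exponents do not occur. -/
lemma CoeffBound.abs_trace_decoupling_le (h : CoeffBound A s V) (T : Matrix ι ι ℝ) (a b N : ℕ)
    {p₀ p₁ : ℝ}
    (H : ∀ X Y : Matrix ι ι ℝ, Xᵀ = X → Yᵀ = Y → ∀ c < a, ∀ e < b,
      |∑ k, ∑ l, (T * (A k * X ^ c * A l * X ^ (a - 1 - c) * A k * Y ^ e * A l *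
        Y ^ (b - 1 - e))).trace| ≤ p₀ + p₁ * ((X ^ N).trace + (Y ^ N).trace)) :
    |(T * (matrixE (covMapPoly A (seriesPoly A ^ a) * seriesPoly A ^ b) -
        covMap A (matrixE (seriesPoly A ^ a)) * matrixE (seriesPoly A ^ b))).trace| ≤
      2 * (a * b * (p₀ + 2 * p₁ * gaussianE (seriesPoly A ^ N).trace)) := by
  classical
  set Z := seriesPoly A with hZ
  set F : ι × ι → MvPolynomial κ ℝ := fun x => (constPoly κ T * covMapPoly A (Z ^ a)) x.1 x.2
  set G : ι × ι → MvPolynomial κ ℝ := fun x => (Z ^ b) x.2 x.1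
  have e1 : (T * (matrixE (covMapPoly A (Z ^ a) * Z ^ b) -
      covMap A (matrixE (Z ^ a)) * matrixE (Z ^ b))).trace =
      ∑ x, (gaussianE (F x * G x) - gaussianE (F x) * gaussianE (G x)) := by
    rw [Matrix.mul_sub, Matrix.trace_sub, ← matrixE_constPoly_mul, trace_matrixE,
      ← Matrix.mul_assoc, trace_mul_eq_sum, map_sum, ← Matrix.mul_assoc, trace_mul_eq_sum,
      ← Finset.sum_sub_distrib]
    refine Finset.sum_congr rfl fun x _ => ?_
    congr 2
    rw [← matrixE_covMapPoly, ← matrixE_constPoly_mul]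
    rfl
  rw [e1]
  refine abs_sum_covariance_le _ F G fun θ => ?_
  -- `f` and `g` evaluate at the correlated Gaussian vectors `x` and `cos θ x + sin θ y`
  set f : MvPolynomial κ ℝ →+* MvPolynomial (κ ⊕ κ) ℝ :=
    (MvPolynomial.rename Sum.inl : MvPolynomial κ ℝ →ₐ[ℝ] MvPolynomial (κ ⊕ κ) ℝ).toRingHom
  set g : MvPolynomial κ ℝ →+* MvPolynomial (κ ⊕ κ) ℝ := (rotate θ).toRingHom
  have ef : ∀ (z : κ ⊕ κ → ℝ) p, MvPolynomial.eval z (f p) =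
      MvPolynomial.eval (fun k => z (Sum.inl k)) p := by
    intro z p
    exact MvPolynomial.eval_rename _ _ _
  have eg : ∀ (z : κ ⊕ κ → ℝ) p, MvPolynomial.eval z (g p) =
      MvPolynomial.eval
        (fun k => Real.cos θ * z (Sum.inl k) + Real.sin θ * z (Sum.inr k)) p := by
    intro z p
    have : (MvPolynomial.eval z).comp g = MvPolynomial.eval
        (fun k => Real.cos θ * z (Sum.inl k) + Real.sin θ * z (Sum.inr k)) := by
      refine MvPolynomial.ringHom_ext (fun r => ?_) fun k => ?_
      · simp [g, rotate, MvPolynomial.algebraMap_eq]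
      · simp [g, rotate_X]
    rw [← this]; rfl
  have key : ∀ z : κ ⊕ κ → ℝ, |MvPolynomial.eval z (∑ x, ∑ l,
      MvPolynomial.rename Sum.inl (MvPolynomial.pderiv l (F x)) *
        rotate θ (MvPolynomial.pderiv l (G x)))| ≤
      MvPolynomial.eval z (MvPolynomial.C (a * b * p₀) + MvPolynomial.C (a * b * p₁) *
        (f (Z ^ N).trace + g (Z ^ N).trace)) := by
    intro z
    set x : κ → ℝ := fun k => z (Sum.inl k)
    set y : κ → ℝ := fun k => Real.cos θ * z (Sum.inl k) + Real.sin θ * z (Sum.inr k)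
    set X : Matrix ι ι ℝ := ∑ k, x k • A k with hX
    set Y : Matrix ι ι ℝ := ∑ k, y k • A k with hY
    have hX1 : Xᵀ = X := h.transpose_series x
    have hY1 : Yᵀ = Y := h.transpose_series y
    have hXp : ∀ n, (MvPolynomial.eval x).mapMatrix (Z ^ n) = X ^ n := by
      intro n; rw [map_pow, map_eval_seriesPoly]
    have hYp : ∀ n, (MvPolynomial.eval y).mapMatrix (Z ^ n) = Y ^ n := by
      intro n; rw [map_pow, map_eval_seriesPoly]
    have hF : ∀ l (u : ι × ι), MvPolynomial.pderiv l (F u) =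
        (constPoly κ T * covMapPoly A (matrixDeriv l (Z ^ a))) u.1 u.2 := by
      intro l u
      rw [← matrixDeriv_covMapPoly]
      have : matrixDeriv l (constPoly κ T * covMapPoly A (Z ^ a)) =
          constPoly κ T * matrixDeriv l (covMapPoly A (Z ^ a)) := by
        rw [matrixDeriv_mul, matrixDeriv_constPoly, Matrix.zero_mul, zero_add]
      rw [← this]; rfl
    have hG : ∀ l (u : ι × ι), MvPolynomial.pderiv l (G u) =
        (matrixDeriv l (Z ^ b)) u.2 u.1 := fun _ _ => rfl
    have e2 : MvPolynomial.eval z (∑ u, ∑ l,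
        MvPolynomial.rename Sum.inl (MvPolynomial.pderiv l (F u)) *
          rotate θ (MvPolynomial.pderiv l (G u))) =
        ∑ c ∈ Finset.range a, ∑ e ∈ Finset.range b, ∑ k, ∑ l,
          (T * (A k * X ^ c * A l * X ^ (a - 1 - c) * A k * Y ^ e * A l *
            Y ^ (b - 1 - e))).trace := by
      have e3 : ∀ l, ∑ u : ι × ι, MvPolynomial.eval z
          (f (MvPolynomial.pderiv l (F u)) * g (MvPolynomial.pderiv l (G u))) =
          ∑ c ∈ Finset.range a, ∑ e ∈ Finset.range b, ∑ k,
            (T * (A k * X ^ c * A l * X ^ (a - 1 - c) * A k * Y ^ e * A l *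
              Y ^ (b - 1 - e))).trace := by
        intro l
        have e4 : (MvPolynomial.eval x).mapMatrix
            (constPoly κ T * covMapPoly A (matrixDeriv l (Z ^ a))) =
            T * covMap A (∑ c ∈ Finset.range a, X ^ c * A l * X ^ (a - 1 - c)) := by
          simp only [map_mul, map_eval_constPoly, map_eval_covMapPoly, hZ,
            matrixDeriv_seriesPoly_pow, map_sum]
          simp only [← hZ, hXp]
        have e5 : (MvPolynomial.eval y).mapMatrix (matrixDeriv l (Z ^ b)) =
            ∑ e ∈ Finset.range b, Y ^ e * A l * Y ^ (b - 1 - e) := by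
          simp only [map_mul, map_eval_constPoly, hZ, matrixDeriv_seriesPoly_pow, map_sum]
          simp only [← hZ, hYp]
        have e6 : ∑ u : ι × ι, MvPolynomial.eval z
            (f (MvPolynomial.pderiv l (F u)) * g (MvPolynomial.pderiv l (G u))) =
            ((T * covMap A (∑ c ∈ Finset.range a, X ^ c * A l * X ^ (a - 1 - c))) *
              ∑ e ∈ Finset.range b, Y ^ e * A l * Y ^ (b - 1 - e)).trace := by
          rw [← e4, ← e5, trace_mul_eq_sum]
          refine Finset.sum_congr rfl fun u _ => ?_
          rw [map_mul, ef, eg, hF, hG]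
          rfl
        rw [e6]
        simp only [covMap, Finset.sum_mul, Finset.mul_sum, Matrix.trace_sum, Matrix.mul_assoc]
        exact (Finset.sum_congr rfl fun e _ => Finset.sum_comm).trans Finset.sum_comm
      rw [Finset.sum_comm, map_sum]
      calc _ = ∑ l, ∑ c ∈ Finset.range a, ∑ e ∈ Finset.range b, ∑ k,
            (T * (A k * X ^ c * A l * X ^ (a - 1 - c) * A k * Y ^ e * A l *
              Y ^ (b - 1 - e))).trace := by
            refine Finset.sum_congr rfl fun l _ => ?_
            rw [← e3, map_sum]; rfl
        _ = _ := by
            refine Finset.sum_comm.trans (Finset.sum_congr rfl fun c _ => ?_)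
            refine Finset.sum_comm.trans (Finset.sum_congr rfl fun e _ => ?_)
            exact Finset.sum_comm
    have e7 : MvPolynomial.eval z (MvPolynomial.C (a * b * p₀) + MvPolynomial.C (a * b * p₁) *
        (f (Z ^ N).trace + g (Z ^ N).trace)) =
        a * b * (p₀ + p₁ * ((X ^ N).trace + (Y ^ N).trace)) := by
      simp only [map_add, map_mul, MvPolynomial.eval_C, ef, eg, eval_trace]
      rw [hXp, hYp]; ring
    rw [e2, e7]
    calc _ ≤ ∑ c ∈ Finset.range a, ∑ e ∈ Finset.range b,
          (p₀ + p₁ * ((X ^ N).trace + (Y ^ N).trace)) :=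
          (Finset.abs_sum_le_sum_abs _ _).trans <| Finset.sum_le_sum fun c hc =>
          (Finset.abs_sum_le_sum_abs _ _).trans <| Finset.sum_le_sum fun e he =>
          H X Y hX1 hY1 c (Finset.mem_range.1 hc) e (Finset.mem_range.1 he)
      _ = _ := by simp only [Finset.sum_const, Finset.card_range, nsmul_eq_mul]; ring
  have hfE : gaussianE (f (Z ^ N).trace) = gaussianE (Z ^ N).trace := gaussianE_rename_inl _
  have hgE : gaussianE (g (Z ^ N).trace) = gaussianE (Z ^ N).trace := gaussianE_rotate _ θ
  have hE : gaussianE (MvPolynomial.C (a * b * p₀) + MvPolynomial.C (a * b * p₁) *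
        (f (Z ^ N).trace + g (Z ^ N).trace)) =
      a * b * (p₀ + 2 * p₁ * gaussianE (Z ^ N).trace) := by
    rw [map_add, gaussianE_C, gaussianE_C_mul, map_add, hfE, hgE]; ring
  rw [← hE, abs_le]
  constructor
  · rw [← map_neg]
    refine gaussianE_mono fun z => ?_
    rw [map_neg]
    exact (abs_le.1 (key z)).1
  · exact gaussianE_mono fun z => (abs_le.1 (key z)).2

end MatrixPolynomial

/-! ### Moment bounds -/

section MomentBounds

variable {ι κ : Type*} [Fintype ι] [DecidableEq ι] [Fintype κ]
variable {A : κ → Matrix ι ι ℝ} {s V : ℝ}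

lemma matrix_norm_pow_le (X : Matrix ι ι ℝ) (c : ℕ) : ‖X ^ c‖ ≤ ‖X‖ ^ c := by
  rcases Nat.eq_zero_or_pos c with rfl | hc
  · simpa using matrix_norm_one_le (ι := ι)
  · exact norm_pow_le' X hc

omit [DecidableEq ι] in
lemma trace_vecMulVec_mul (u w : ι → ℝ) (M : Matrix ι ι ℝ) :
    (Matrix.vecMulVec w u * M).trace = u ⬝ᵥ M *ᵥ w := by
  rw [Matrix.vecMulVec_mul, Matrix.trace_vecMulVec, Matrix.dotProduct_mulVec, dotProduct_comm]

/-- The decoupling error in operator norm. The moment hypothesis `E Tr Z ^ N ≤ 2 ^ N` makes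
`‖Z‖` bounded by `2` for this purpose, so each crossing word costs `2 ^ degree`. -/
lemma CoeffBound.norm_decoupling_le [Nonempty ι] (h : CoeffBound A s V) {N : ℕ} (hN : Even N)
    (hN0 : N ≠ 0) (hτ : gaussianE (seriesPoly A ^ N).trace ≤ 2 ^ N) {a b : ℕ}
    (hab : (a - 1) + (b - 1) ≤ N) :
    ‖matrixE (covMapPoly A (seriesPoly A ^ a) * seriesPoly A ^ b) -
        covMap A (matrixE (seriesPoly A ^ a)) * matrixE (seriesPoly A ^ b)‖ ≤
      6 * (a * b) * (s * V) * 2 ^ ((a - 1) + (b - 1)) := by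
  have hsV := mul_nonneg h.variance_nonneg h.covariance_nonneg
  refine matrix_norm_le_of_bilin _ (by positivity) fun u w => ?_
  set r := (a - 1) + (b - 1) with hr
  set ρ := √(∑ i, u i ^ 2) * √(∑ i, w i ^ 2) with hρ
  have hρ0 : 0 ≤ ρ := by positivity
  have key := h.abs_trace_decoupling_le (Matrix.vecMulVec w u) a b N
    (p₀ := s * V * ρ * 2 ^ r) (p₁ := s * V * ρ * 2 ^ r * (2 ^ N)⁻¹) ?_
  · rw [trace_vecMulVec_mul] at key
    refine (le_abs_self _).trans (key.trans ?_)
    have h1 : (2 ^ N : ℝ)⁻¹ * gaussianE (seriesPoly A ^ N).trace ≤ 1 := by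
      rw [inv_mul_le_iff₀ (by positivity), mul_one]; exact hτ
    have h2 : s * V * ρ * 2 ^ r + 2 * (s * V * ρ * 2 ^ r * (2 ^ N)⁻¹) *
        gaussianE (seriesPoly A ^ N).trace ≤ 3 * (s * V * ρ * 2 ^ r) := by
      have : 0 ≤ s * V * ρ * 2 ^ r := by positivity
      nlinarith [mul_le_mul_of_nonneg_left h1 this]
    calc _ ≤ 2 * (a * b * (3 * (s * V * ρ * 2 ^ r))) := by gcongr
      _ = _ := by ring
  · intro X Y hX hY c hc e he
    have e1 : ∀ k l, (Matrix.vecMulVec w u * (A k * X ^ c * A l * X ^ (a - 1 - c) * A k * Y ^ e *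
        A l * Y ^ (b - 1 - e))).trace =
        u ⬝ᵥ (A k * X ^ c * A l * X ^ (a - 1 - c) * A k * Y ^ e * A l) *ᵥ
          (Y ^ (b - 1 - e) *ᵥ w) := by
      intro k l
      rw [trace_vecMulVec_mul, Matrix.mulVec_mulVec]
    simp only [e1]
    refine (h.bilin_crossing_le _ _ _ u _).trans ?_
    have h1 : √(∑ i, (Y ^ (b - 1 - e) *ᵥ w) i ^ 2) ≤ ‖Y‖ ^ (b - 1 - e) * √(∑ i, w i ^ 2) := by
      refine (Real.sqrt_le_sqrt (sum_sq_mulVec_le _ w)).trans ?_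
      rw [Real.sqrt_mul (sq_nonneg _), Real.sqrt_sq (norm_nonneg _)]
      gcongr
      exact matrix_norm_pow_le _ _
    have h2 : ‖X‖ ^ (a - 1) * ‖Y‖ ^ (b - 1) ≤
        2 ^ r * (1 + (2 ^ N)⁻¹ * ((X ^ N).trace + (Y ^ N).trace)) := by
      have h3 := mul_pow_le_sum_pow (a := a - 1) (b := b - 1) (c := 0) (e := 0) hN (by omega)
        (‖X‖ / 2) (‖Y‖ / 2) 0 0
      have hXN := norm_pow_le_trace_pow hX hN
      have hYN := norm_pow_le_trace_pow hY hN
      simp only [pow_zero, mul_one, zero_pow hN0, add_zero, div_pow, abs_div, abs_norm,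
        abs_two] at h3
      have h4 : ‖X‖ ^ N / 2 ^ N ≤ (2 ^ N)⁻¹ * (X ^ N).trace := by
        rw [div_eq_inv_mul]; gcongr
      have h5 : ‖Y‖ ^ N / 2 ^ N ≤ (2 ^ N)⁻¹ * (Y ^ N).trace := by
        rw [div_eq_inv_mul]; gcongr
      calc ‖X‖ ^ (a - 1) * ‖Y‖ ^ (b - 1) =
          2 ^ r * (‖X‖ ^ (a - 1) / 2 ^ (a - 1) * (‖Y‖ ^ (b - 1) / 2 ^ (b - 1))) := by
            rw [hr, pow_add]; field_simp
        _ ≤ _ := by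
            refine mul_le_mul_of_nonneg_left ?_ (by positivity)
            rw [mul_add]; linarith
    calc _ ≤ s * V * (‖X‖ ^ c * ‖X‖ ^ (a - 1 - c) * ‖Y‖ ^ e) *
          (√(∑ i, u i ^ 2) * (‖Y‖ ^ (b - 1 - e) * √(∑ i, w i ^ 2))) := by
          gcongr <;> exact matrix_norm_pow_le _ _
      _ = s * V * ρ * (‖X‖ ^ (c + (a - 1 - c)) * ‖Y‖ ^ (e + (b - 1 - e))) := by
          rw [pow_add, pow_add, hρ]; ring
      _ = s * V * ρ * (‖X‖ ^ (a - 1) * ‖Y‖ ^ (b - 1)) := by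
          rw [show c + (a - 1 - c) = a - 1 by omega, show e + (b - 1 - e) = b - 1 by omega]
      _ ≤ s * V * ρ * (2 ^ r * (1 + (2 ^ N)⁻¹ * ((X ^ N).trace + (Y ^ N).trace))) := by gcongr
      _ = _ := by ring

/-- The decoupling error for the trace. -/
lemma CoeffBound.trace_decoupling_le (h : CoeffBound A s V) {N : ℕ} (hN : Even N)
    (hτ : gaussianE (seriesPoly A ^ N).trace = Fintype.card ι) {a b : ℕ}
    (hab : (a - 1) + (b - 1) ≤ N) :
    |(matrixE (covMapPoly A (seriesPoly A ^ a) * seriesPoly A ^ b)).trace -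
        (covMap A (matrixE (seriesPoly A ^ a)) * matrixE (seriesPoly A ^ b)).trace| ≤
      10 * (a * b) * (s * V) * Fintype.card ι := by
  have key := h.abs_trace_decoupling_le 1 a b N
    (p₀ := s * V * Fintype.card ι) (p₁ := 2 * (s * V)) ?_
  · rw [Matrix.one_mul, Matrix.trace_sub, hτ] at key
    refine key.trans (le_of_eq ?_)
    ring
  · intro X Y hX hY c hc e he
    simp only [Matrix.one_mul]
    refine (h.abs_trace_crossing_le hX hY hN (by omega)).trans (le_of_eq ?_)
    ring

lemma abs_gaussianE_le {κ' : Type*} [Fintype κ'] {p q : MvPolynomial κ' ℝ}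
    (h : ∀ x, |MvPolynomial.eval x p| ≤ MvPolynomial.eval x q) : |gaussianE p| ≤ gaussianE q := by
  rw [abs_le]
  constructor
  · rw [← map_neg]
    exact gaussianE_mono fun x => by rw [map_neg]; exact (abs_le.1 (h x)).1
  · exact gaussianE_mono fun x => (abs_le.1 (h x)).2

lemma CoeffBound.abs_trace_mul_matrixE_le (h : CoeffBound A s V) {N : ℕ} (hN : Even N)
    (hτ : gaussianE (seriesPoly A ^ N).trace = Fintype.card ι) (T : Matrix ι ι ℝ) {b : ℕ}
    (hb : b ≤ N) :
    |(T * matrixE (seriesPoly A ^ b)).trace| ≤ ‖T‖ * (2 * Fintype.card ι) := by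
  rw [← matrixE_constPoly_mul, trace_matrixE]
  have h1 := abs_gaussianE_le (p := (constPoly κ T * seriesPoly A ^ b).trace)
    (q := MvPolynomial.C ‖T‖ * (MvPolynomial.C (Fintype.card ι : ℝ) + (seriesPoly A ^ N).trace))
    fun x => by
      have h2 := abs_trace_mul_pow_le T (h.transpose_series x) hN hb
      rw [eval_trace, map_mul, map_eval_constPoly, map_pow, map_eval_seriesPoly, map_mul, map_add,
        MvPolynomial.eval_C, MvPolynomial.eval_C, eval_trace, map_pow, map_eval_seriesPoly]
      exact h2
  refine h1.trans (le_of_eq ?_)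
  rw [gaussianE_C_mul, map_add, gaussianE_C, hτ]
  ring

omit [DecidableEq ι] in
lemma trace_covMap_mul_comm (A : κ → Matrix ι ι ℝ) (M M' : Matrix ι ι ℝ) :
    (covMap A M * M').trace = (covMap A M' * M).trace := by
  simp only [covMap, Finset.sum_mul, Matrix.trace_sum]
  refine Finset.sum_congr rfl fun k _ => ?_
  rw [Matrix.mul_assoc, Matrix.mul_assoc, Matrix.trace_mul_comm, Matrix.mul_assoc,
    Matrix.trace_mul_comm (A k * M' * A k)]

/-- The trace of decoupled factors is the expectation over two independent copies. -/
lemma trace_covMap_matrixE_mul (A : κ → Matrix ι ι ℝ) (a b : ℕ) :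
    (covMap A (matrixE (seriesPoly A ^ a)) * matrixE (seriesPoly A ^ b)).trace =
      gaussianE (∑ u : ι × ι,
        MvPolynomial.rename Sum.inl (covMapPoly A (seriesPoly A ^ a) u.1 u.2) *
        MvPolynomial.rename Sum.inr ((seriesPoly A ^ b) u.2 u.1)) := by
  rw [map_sum, ← matrixE_covMapPoly, trace_mul_eq_sum]
  refine Finset.sum_congr rfl fun u _ => ?_
  rw [gaussianE_rename_inl_mul_rename_inr]
  rfl

lemma eval_independent_trace (A : κ → Matrix ι ι ℝ) (a b : ℕ) (z : κ ⊕ κ → ℝ) :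
    MvPolynomial.eval z
      (∑ u : ι × ι, MvPolynomial.rename Sum.inl (covMapPoly A (seriesPoly A ^ a) u.1 u.2) *
        MvPolynomial.rename Sum.inr ((seriesPoly A ^ b) u.2 u.1)) =
    (covMap A ((∑ k, z (Sum.inl k) • A k) ^ a) * (∑ k, z (Sum.inr k) • A k) ^ b).trace := by
  rw [← map_eval_seriesPoly, ← map_eval_seriesPoly, ← map_pow, ← map_pow, ← map_eval_covMapPoly,
    trace_mul_eq_sum, map_sum]
  refine Finset.sum_congr rfl fun u _ => ?_
  rw [map_mul, MvPolynomial.eval_rename, MvPolynomial.eval_rename]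
  rfl

/-- In the middle range `m ≤ a, b` the decoupled trace is controlled by the `m`-th moment. -/
lemma CoeffBound.abs_trace_middle_le (h : CoeffBound A s V) {N : ℕ} (hN : Even N)
    (hτ : gaussianE (seriesPoly A ^ N).trace = Fintype.card ι) {m a b : ℕ} (hm : Even m)
    (ha : m ≤ a) (hb : m ≤ b) (hab : a + b + 2 = N) :
    |(covMap A (matrixE (seriesPoly A ^ a)) * matrixE (seriesPoly A ^ b)).trace| ≤
      4 * s * ‖matrixE (seriesPoly A ^ m)‖ * Fintype.card ι := by
  obtain ⟨c, hc⟩ := Nat.exists_eq_add_of_le (show m ≤ a + b by omega)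
  have hce : Even c := by
    have h1 : Even (m + c + 2) := by rw [← hc, hab]; exact hN
    have h2 : Even (m + (c + 2)) := by rwa [← add_assoc]
    have := (Nat.even_add.1 h2).1 hm
    exact (Nat.even_add.1 this).2 even_two
  have h1 : |(covMap A (matrixE (seriesPoly A ^ a)) * matrixE (seriesPoly A ^ b)).trace| ≤
      (covMap A (matrixE (seriesPoly A ^ m)) * matrixE (seriesPoly A ^ c)).trace +
      (covMap A (matrixE (seriesPoly A ^ c)) * matrixE (seriesPoly A ^ m)).trace := by
    rw [trace_covMap_matrixE_mul, trace_covMap_matrixE_mul, trace_covMap_matrixE_mul, ← map_add]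
    refine abs_gaussianE_le fun z => ?_
    rw [map_add, eval_independent_trace, eval_independent_trace, eval_independent_trace]
    exact abs_trace_covMap_pow_mul_pow_le h.symm (h.transpose_series _) (h.transpose_series _)
      hm hce hc ha hb
  rw [trace_covMap_mul_comm A (matrixE (seriesPoly A ^ c))] at h1
  have h2 := h.abs_trace_mul_matrixE_le hN hτ (covMap A (matrixE (seriesPoly A ^ m)))
    (show c ≤ N by omega)
  have h3 := h.norm_covMap_le (matrixE (seriesPoly A ^ m))
  have h4 : ‖covMap A (matrixE (seriesPoly A ^ m))‖ * (2 * (Fintype.card ι : ℝ)) ≤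
      s * ‖matrixE (seriesPoly A ^ m)‖ * (2 * Fintype.card ι) := by gcongr
  linarith [(abs_le.1 h2).2]

lemma CoeffBound.abs_trace_left_le (h : CoeffBound A s V) {N : ℕ} (hN : Even N)
    (hτ : gaussianE (seriesPoly A ^ N).trace = Fintype.card ι) (a : ℕ) {b : ℕ} (hb : b ≤ N) :
    |(covMap A (matrixE (seriesPoly A ^ a)) * matrixE (seriesPoly A ^ b)).trace| ≤
      2 * s * ‖matrixE (seriesPoly A ^ a)‖ * Fintype.card ι := by
  refine (h.abs_trace_mul_matrixE_le hN hτ _ hb).trans ?_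
  calc _ ≤ s * ‖matrixE (seriesPoly A ^ a)‖ * (2 * (Fintype.card ι : ℝ)) := by
        gcongr; exact h.norm_covMap_le _
    _ = _ := by ring

lemma sum_convolution_le (x : ℕ → ℝ) (hx : ∀ i, 0 ≤ x i) (n : ℕ) :
    ∑ q ∈ Finset.range (n + 1), ∑ c ∈ Finset.range q, x c * x (q - 1 - c) ≤
      (∑ q ∈ Finset.range (n + 1), x q) ^ 2 := by
  have e : ∑ q ∈ Finset.range (n + 1), ∑ c ∈ Finset.range q, x c * x (q - 1 - c) =
      ∑ c ∈ Finset.range (n + 1), ∑ q ∈ Finset.Ico (c + 1) (n + 1), x c * x (q - 1 - c) := by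
    refine Finset.sum_comm' fun q c => ?_
    simp only [Finset.mem_range, Finset.mem_Ico]; omega
  rw [e, sq, Finset.sum_mul_sum]
  refine Finset.sum_le_sum fun c _ => ?_
  rw [Finset.sum_Ico_eq_sum_range]
  calc _ = ∑ i ∈ Finset.range (n + 1 - (c + 1)), x c * x i := by
        refine Finset.sum_congr rfl fun i _ => ?_
        congr 2; omega
    _ ≤ _ := Finset.sum_le_sum_of_subset_of_nonneg
        (Finset.range_subset_range.2 (by omega)) fun i _ _ => mul_nonneg (hx _) (hx _)

lemma cube_le_four_mul_two_pow (q : ℕ) : (q : ℝ) ^ 3 ≤ 4 * 2 ^ q := by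
  suffices h : q ^ 3 ≤ 4 * 2 ^ q by exact_mod_cast h
  rcases lt_or_ge q 4 with hq | hq
  · interval_cases q <;> norm_num
  · induction q, hq using Nat.le_induction with
    | base => norm_num
    | succ n hn ih =>
      rw [pow_succ 2]
      nlinarith [Nat.mul_le_mul hn hn, Nat.mul_le_mul hn (Nat.mul_le_mul hn hn)]

/-- Bound on the low moments in operator norm, in a weighted `ℓ¹` form: the Schwinger-Dyson
equations make this a perturbation of the Catalan recursion. -/
lemma CoeffBound.sum_norm_moments_le [Nonempty ι] (h : CoeffBound A s V) {N m : ℕ} (hN : Even N)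
    (hN0 : N ≠ 0) (hτ : gaussianE (seriesPoly A ^ N).trace ≤ 2 ^ N) (hmN : m ≤ N + 1)
    (hm : (2 : ℝ) ^ m ≤ 4 * N) (hs : s ≤ 1 / 100) (hV : N ^ 3 * V ≤ 1 / 100) :
    ∀ n ≤ m, ∑ q ∈ Finset.range (n + 1), 2 ^ q * ‖matrixE (seriesPoly A ^ q)‖ ≤ 2 := by
  have hs0 := h.variance_nonneg
  have hV0 := h.covariance_nonneg
  have hsV := mul_nonneg hs0 hV0
  intro n
  induction n with
  | zero =>
    intro _
    have := matrix_norm_one_le (ι := ι)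
    simp only [zero_add, Finset.sum_range_one, pow_zero, matrixE_one, one_mul]
    linarith
  | succ n ih =>
    intro hn
    have ih := ih (by omega)
    set x : ℕ → ℝ := fun q => 2 ^ q * ‖matrixE (seriesPoly A ^ q)‖ with hx
    have hx0 : ∀ q, 0 ≤ x q := fun q => by positivity
    change ∑ q ∈ Finset.range (n + 1), x q ≤ 2 at ih
    rw [Finset.sum_range_succ']
    have h0 : 2 ^ 0 * ‖matrixE (seriesPoly A ^ 0)‖ ≤ 1 := by
      rw [pow_zero, pow_zero, one_mul, matrixE_one]; exact matrix_norm_one_le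
    -- the weights `2 ^ q` turn the products of moments into a convolution square, and the error of
    -- degree `q` into `q ^ 3 * 4 ^ q ≤ 4 * 8 ^ q`
    have hstep : ∀ q ∈ Finset.range (n + 1), 2 ^ (q + 1) * ‖matrixE (seriesPoly A ^ (q + 1))‖ ≤
        4 * s * (∑ c ∈ Finset.range q, x c * x (q - 1 - c)) + 48 * (s * V) * 8 ^ q := by
      intro q hq
      have hq := Finset.mem_range.1 hq
      rw [matrixE_seriesPoly_pow_succ]
      have h1 : ∀ c ∈ Finset.range q,
          ‖matrixE (covMapPoly A (seriesPoly A ^ c) * seriesPoly A ^ (q - 1 - c))‖ ≤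
          s * (‖matrixE (seriesPoly A ^ c)‖ * ‖matrixE (seriesPoly A ^ (q - 1 - c))‖) +
            6 * (q * q) * (s * V) * 2 ^ q := by
        intro c hc
        have hc := Finset.mem_range.1 hc
        have h2 := h.norm_decoupling_le hN hN0 hτ (a := c) (b := q - 1 - c) (by omega)
        have h3 : 6 * ((c : ℝ) * ((q - 1 - c : ℕ) : ℝ)) * (s * V) *
            2 ^ ((c - 1) + (q - 1 - c - 1)) ≤ 6 * (q * q) * (s * V) * 2 ^ q := by
          have i1 : (c : ℝ) ≤ q := by exact_mod_cast hc.le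
          have i2 : ((q - 1 - c : ℕ) : ℝ) ≤ q := by exact_mod_cast (by omega : q - 1 - c ≤ q)
          gcongr
          · norm_num
          · omega
        have h4 : ‖covMap A (matrixE (seriesPoly A ^ c)) *
            matrixE (seriesPoly A ^ (q - 1 - c))‖ ≤
            s * (‖matrixE (seriesPoly A ^ c)‖ * ‖matrixE (seriesPoly A ^ (q - 1 - c))‖) := by
          refine (Matrix.l2_opNorm_mul _ _).trans ?_
          rw [← mul_assoc]
          gcongr
          exact h.norm_covMap_le _
        have h5 := norm_le_norm_add_norm_sub' (matrixE (covMapPoly A (seriesPoly A ^ c) *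
          seriesPoly A ^ (q - 1 - c))) (covMap A (matrixE (seriesPoly A ^ c)) *
            matrixE (seriesPoly A ^ (q - 1 - c)))
        linarith
      have h6 := (norm_sum_le _ _).trans (Finset.sum_le_sum h1)
      rw [Finset.sum_add_distrib, Finset.sum_const, Finset.card_range, nsmul_eq_mul,
        ← Finset.mul_sum] at h6
      have h7 : ∑ c ∈ Finset.range q, x c * x (q - 1 - c) = 2 ^ q * (2 : ℝ)⁻¹ *
          ∑ c ∈ Finset.range q,
            ‖matrixE (seriesPoly A ^ c)‖ * ‖matrixE (seriesPoly A ^ (q - 1 - c))‖ := by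
        rw [Finset.mul_sum]
        refine Finset.sum_congr rfl fun c hc => ?_
        have hc := Finset.mem_range.1 hc
        have : (2 : ℝ) ^ q = 2 * (2 ^ c * 2 ^ (q - 1 - c)) := by
          rw [← pow_add, ← pow_succ']; congr 1; omega
        simp only [hx]
        rw [this]; ring
      have h8 := cube_le_four_mul_two_pow q
      have h9 : (8 : ℝ) ^ q = 2 ^ q * 2 ^ q * 2 ^ q := by rw [← mul_pow, ← mul_pow]; norm_num
      calc _ ≤ 2 ^ (q + 1) * (s * (∑ c ∈ Finset.range q,
              ‖matrixE (seriesPoly A ^ c)‖ * ‖matrixE (seriesPoly A ^ (q - 1 - c))‖) +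
            q * (6 * (q * q) * (s * V) * 2 ^ q)) := by gcongr
        _ = 4 * s * (∑ c ∈ Finset.range q, x c * x (q - 1 - c)) +
            12 * (s * V) * (2 ^ q * 2 ^ q) * q ^ 3 := by rw [h7, pow_succ]; ring
        _ ≤ 4 * s * (∑ c ∈ Finset.range q, x c * x (q - 1 - c)) +
            12 * (s * V) * (2 ^ q * 2 ^ q) * (4 * 2 ^ q) := by gcongr
        _ = _ := by rw [h9]; ring
    have hsum := Finset.sum_le_sum hstep
    rw [Finset.sum_add_distrib, ← Finset.mul_sum, ← Finset.mul_sum] at hsum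
    have hconv := sum_convolution_le x hx0 n
    have hS0 : 0 ≤ ∑ q ∈ Finset.range (n + 1), x q := Finset.sum_nonneg fun q _ => hx0 q
    have hconv2 : (∑ q ∈ Finset.range (n + 1), x q) ^ 2 ≤ 4 := by nlinarith
    have hgeom : ∑ q ∈ Finset.range (n + 1), (8 : ℝ) ^ q ≤ 8 ^ (n + 1) := by
      rw [geom_sum_eq (by norm_num)]
      have : (0 : ℝ) < 8 ^ (n + 1) := by positivity
      linarith
    have h8m : (8 : ℝ) ^ (n + 1) ≤ 64 * N ^ 3 := by
      have : (2 : ℝ) ^ (n + 1) ≤ 4 * N :=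
        (pow_le_pow_right₀ (by norm_num) hn).trans hm
      calc (8 : ℝ) ^ (n + 1) = (2 ^ (n + 1)) ^ 3 := by
            rw [← pow_mul, mul_comm, pow_mul]; norm_num
        _ ≤ (4 * N) ^ 3 := by gcongr
        _ = _ := by ring
    have hf1 : 4 * s * ∑ q ∈ Finset.range (n + 1), ∑ c ∈ Finset.range q, x c * x (q - 1 - c) ≤
        4 * (1 / 100) * 4 := by
      have : 4 * s * ∑ q ∈ Finset.range (n + 1), ∑ c ∈ Finset.range q, x c * x (q - 1 - c) ≤
          4 * s * 4 := by gcongr; exact hconv.trans hconv2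
      linarith
    have hf2 : 48 * (s * V) * ∑ q ∈ Finset.range (n + 1), (8 : ℝ) ^ q ≤
        48 * 64 * (1 / 100) * (1 / 100) := by
      calc _ ≤ 48 * (s * V) * (64 * N ^ 3) := by gcongr; exact hgeom.trans h8m
        _ = 48 * 64 * s * (N ^ 3 * V) := by ring
        _ ≤ _ := by gcongr
    linarith

/-- Under the smallness conditions the normalized moment `E Tr Z ^ N / card ι` cannot be `1`. In the
Schwinger-Dyson equation for `E Tr Z ^ N`, the terms with `a` or `b` below a cutoff `m` of order
`log N` are summable, and in the middle range the smallness of the `m`-th moment beats the number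
of terms. -/
lemma CoeffBound.trace_moment_ne [Nonempty ι] (h : CoeffBound A s V) {N : ℕ} (hN : Even N)
    (hN0 : N ≠ 0) (hι : (Fintype.card ι : ℝ) ≤ 2 ^ N) (hs : s ≤ 1 / 100)
    (hV : N ^ 3 * V ≤ 1 / 100) :
    gaussianE (seriesPoly A ^ N).trace ≠ Fintype.card ι := by
  intro hτ
  have hs0 := h.variance_nonneg
  have hV0 := h.covariance_nonneg
  have hsV := mul_nonneg hs0 hV0
  set D : ℝ := (Fintype.card ι : ℝ) with hD
  have hD0 : 0 < D := by rw [hD]; exact_mod_cast Fintype.card_pos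
  have hN2 : 2 ≤ N := by obtain ⟨t, rfl⟩ := hN; omega
  -- an even cutoff `m` with `N ≤ 2 ^ m ≤ 4 N`
  set m := 2 * Nat.clog 4 N with hm
  have hm1 : (N : ℝ) ≤ 2 ^ m := by
    have : N ≤ 4 ^ Nat.clog 4 N := Nat.le_pow_clog (by norm_num) N
    rw [hm, pow_mul]; norm_num; exact_mod_cast this
  have hm2 : (2 : ℝ) ^ m ≤ 4 * N := by
    have h1 := Nat.pow_pred_clog_lt_self (b := 4) (by norm_num) (show 1 < N by omega)
    have h2 : 0 < Nat.clog 4 N := Nat.clog_pos (by norm_num) hN2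
    have h3 : 4 ^ Nat.clog 4 N = 4 * 4 ^ (Nat.clog 4 N).pred := by
      rw [← pow_succ']; congr 1; exact (Nat.succ_pred_eq_of_pos h2).symm
    have h4 : 4 ^ Nat.clog 4 N ≤ 4 * N := by rw [h3]; omega
    rw [hm, pow_mul]; norm_num; exact_mod_cast h4
  have hmN : m ≤ N + 1 := by
    by_contra hcon
    have h1 : (2 : ℝ) ^ (N + 2) ≤ 4 * N :=
      (pow_le_pow_right₀ (by norm_num) (by omega)).trans hm2
    have h2 : (N : ℝ) < 2 ^ N := by exact_mod_cast Nat.lt_two_pow_self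
    rw [pow_add] at h1
    linarith
  set μ : ℕ → ℝ := fun q => ‖matrixE (seriesPoly A ^ q)‖ with hμ
  have hμ0 : ∀ q, 0 ≤ μ q := fun q => norm_nonneg _
  have hT := h.sum_norm_moments_le hN hN0 (hτ.le.trans hι) hmN hm2 hs hV m le_rfl
  have hlow : ∑ q ∈ Finset.range m, μ q ≤ 2 := by
    refine le_trans ?_ hT
    rw [Finset.sum_range_succ]
    have h1 : ∑ q ∈ Finset.range m, μ q ≤ ∑ q ∈ Finset.range m, 2 ^ q * μ q :=
      Finset.sum_le_sum fun q _ => le_mul_of_one_le_left (hμ0 q) (one_le_pow₀ (by norm_num))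
    have h2 : 0 ≤ 2 ^ m * μ m := by positivity
    linarith
  have hmid : N * μ m ≤ 2 := by
    have h1 : 2 ^ m * μ m ≤ 2 := by
      refine le_trans ?_ hT
      exact Finset.single_le_sum (f := fun q => 2 ^ q * μ q) (fun q _ => by positivity)
        (Finset.mem_range.2 (Nat.lt_succ_self m))
    exact (mul_le_mul_of_nonneg_right hm1 (hμ0 m)).trans h1
  set f : ℕ → ℝ := fun a => if a < m then μ a else 0 with hf
  have hf0 : ∀ a, 0 ≤ f a := fun a => by
    simp only [hf]; split_ifs; exacts [hμ0 a, le_rfl]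
  have hfsum : ∀ n, ∑ a ∈ Finset.range n, f a ≤ 2 := by
    intro n
    refine le_trans ?_ hlow
    simp only [hf]
    rw [← Finset.sum_filter]
    refine Finset.sum_le_sum_of_subset_of_nonneg (fun a ha => ?_) fun a _ _ => hμ0 a
    exact Finset.mem_range.2 (Finset.mem_filter.1 ha).2
  obtain ⟨n, rfl⟩ : ∃ n, N = n + 1 := ⟨N - 1, by omega⟩
  have hterm : ∀ a ∈ Finset.range n,
      (matrixE (covMapPoly A (seriesPoly A ^ a) * seriesPoly A ^ (n - 1 - a))).trace ≤
      2 * s * D * (f a + f (n - 1 - a) + 2 * μ m) + 10 * (s * V) * D * (n + 1) ^ 2 := by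
    intro a ha
    have ha := Finset.mem_range.1 ha
    have h1 := h.trace_decoupling_le hN hτ (a := a) (b := n - 1 - a) (by omega)
    have h2 : |(covMap A (matrixE (seriesPoly A ^ a)) *
        matrixE (seriesPoly A ^ (n - 1 - a))).trace| ≤
        2 * s * D * (f a + f (n - 1 - a) + 2 * μ m) := by
      have hsD : 0 ≤ 2 * s * D := by positivity
      have k1 := hf0 a
      have k2 := hf0 (n - 1 - a)
      have k3 := hμ0 m
      by_cases c1 : a < m
      · have h3 := h.abs_trace_left_le hN hτ a (b := n - 1 - a) (by omega)
        have h4 : f a = μ a := if_pos c1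
        calc _ ≤ 2 * s * D * f a := by rw [h4]; exact h3.trans_eq (by simp only [hμ, hD]; ring)
          _ ≤ _ := by gcongr; linarith
      · by_cases c2 : n - 1 - a < m
        · have h3 := h.abs_trace_left_le hN hτ (n - 1 - a) (b := a) (by omega)
          rw [trace_covMap_mul_comm] at h3
          have h4 : f (n - 1 - a) = μ (n - 1 - a) := if_pos c2
          calc _ ≤ 2 * s * D * f (n - 1 - a) := by
                rw [h4]; exact h3.trans_eq (by simp only [hμ, hD]; ring)
            _ ≤ _ := by gcongr; linarith
        · have h3 := h.abs_trace_middle_le hN hτ (m := m) (a := a) (b := n - 1 - a)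
            (even_two_mul _) (by omega) (by omega) (by omega)
          calc _ ≤ 2 * s * D * (2 * μ m) := h3.trans_eq (by simp only [hμ, hD]; ring)
            _ ≤ _ := by gcongr; linarith
    have h5 : 10 * ((a : ℝ) * ((n - 1 - a : ℕ) : ℝ)) * (s * V) * D ≤
        10 * (s * V) * D * (n + 1) ^ 2 := by
      have i1 : (a : ℝ) ≤ n + 1 := by exact_mod_cast (by omega : a ≤ n + 1)
      have i2 : ((n - 1 - a : ℕ) : ℝ) ≤ n + 1 := by exact_mod_cast (by omega : n - 1 - a ≤ n + 1)
      calc _ ≤ 10 * (((n : ℝ) + 1) * (n + 1)) * (s * V) * D := by gcongr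
        _ = _ := by ring
    linarith [(abs_le.1 h1).2, (abs_le.1 h2).2]
  have hsum := Finset.sum_le_sum hterm
  rw [← Matrix.trace_sum, ← matrixE_seriesPoly_pow_succ, trace_matrixE, hτ, Finset.sum_add_distrib,
    ← Finset.mul_sum, Finset.sum_add_distrib, Finset.sum_add_distrib,
    Finset.sum_range_reflect f n, Finset.sum_const, Finset.sum_const, Finset.card_range,
    nsmul_eq_mul, nsmul_eq_mul] at hsum
  push_cast at hmid hV
  have g1 : ∑ a ∈ Finset.range n, f a + ∑ a ∈ Finset.range n, f a + n * (2 * μ m) ≤ 8 := by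
    have := hfsum n
    have := hμ0 m
    linarith
  have g2 : n * (10 * (s * V) * D * (n + 1) ^ 2) ≤ 10 * D * (1 / 100) * (1 / 100) := by
    have hn0 : (0 : ℝ) ≤ n := Nat.cast_nonneg n
    calc _ ≤ ((n : ℝ) + 1) * (10 * (s * V) * D * (n + 1) ^ 2) := by gcongr; linarith
      _ = 10 * D * s * ((n + 1) ^ 3 * V) := by ring
      _ ≤ _ := by gcongr
  have g3 : 2 * s * D * (∑ a ∈ Finset.range n, f a + ∑ a ∈ Finset.range n, f a + n * (2 * μ m)) ≤
      2 * (1 / 100) * D * 8 := by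
    have := hfsum n
    calc _ ≤ 2 * s * D * 8 := by gcongr
      _ ≤ _ := by gcongr
  linarith

lemma seriesPoly_smul (A : κ → Matrix ι ι ℝ) (r : ℝ) :
    seriesPoly (fun k => r • A k) = (MvPolynomial.C r : MvPolynomial κ ℝ) • seriesPoly A := by
  ext1 i j
  simp [seriesPoly, constPoly, Matrix.sum_apply, Finset.mul_sum, mul_left_comm]

lemma gaussianE_trace_seriesPoly_smul (A : κ → Matrix ι ι ℝ) (r : ℝ) (N : ℕ) :
    gaussianE (seriesPoly (fun k => r • A k) ^ N).trace =
      r ^ N * gaussianE (seriesPoly A ^ N).trace := by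
  rw [seriesPoly_smul, smul_pow, Matrix.trace_smul, ← map_pow, smul_eq_mul, gaussianE_C_mul]

omit [DecidableEq ι] in
lemma CoeffBound.smul (h : CoeffBound A s V) (r : ℝ) :
    CoeffBound (fun k => r • A k) (r ^ 2 * s) (r ^ 2 * V) where
  symm k := by rw [Matrix.transpose_smul, h.symm]
  variance_nonneg := mul_nonneg (sq_nonneg _) h.variance_nonneg
  covariance_nonneg := mul_nonneg (sq_nonneg _) h.covariance_nonneg
  variance w := by
    have := mul_le_mul_of_nonneg_left (h.variance w) (sq_nonneg r)
    simpa [Matrix.smul_mulVec, mul_pow, Finset.mul_sum, mul_assoc] using this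
  covariance c := by
    have h1 : ∑ k, c k • r • A k = ∑ k, (r * c k) • A k :=
      Finset.sum_congr rfl fun k _ => by rw [smul_smul, mul_comm]
    have := h.covariance fun k => r * c k
    rw [h1]
    refine this.trans_eq ?_
    simp only [mul_pow, ← Finset.mul_sum]; ring

/-- The moment estimate: if the variance is at most `1 / 100` and the covariance is at most
`1 / (100 N ^ 3)`, the normalized `N`-th trace moment is at most `1`. -/
theorem CoeffBound.trace_moment_le [Nonempty ι] (h : CoeffBound A s V) {N : ℕ} (hN : Even N)
    (hN0 : N ≠ 0) (hι : (Fintype.card ι : ℝ) ≤ 2 ^ N) (hs : s ≤ 1 / 100)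
    (hV : N ^ 3 * V ≤ 1 / 100) :
    gaussianE (seriesPoly A ^ N).trace ≤ Fintype.card ι := by
  by_contra! hcon
  set D : ℝ := (Fintype.card ι : ℝ) with hD
  have hD0 : 0 < D := by rw [hD]; exact_mod_cast Fintype.card_pos
  set τ := gaussianE (seriesPoly A ^ N).trace
  have hτ0 : 0 < τ := hD0.trans hcon
  -- shrinking the coefficients until equality holds
  set r := (D / τ) ^ ((N : ℝ)⁻¹) with hr
  have hrN : r ^ N = D / τ := Real.rpow_inv_natCast_pow (by positivity) hN0
  have hr0 : 0 ≤ r := by positivity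
  have hr1 : r ^ 2 ≤ 1 := by
    refine pow_le_one₀ hr0 (Real.rpow_le_one (by positivity) ?_ (by positivity))
    rw [div_le_one hτ0]; exact hcon.le
  have hs0 := h.variance_nonneg
  have hV0 := h.covariance_nonneg
  refine (h.smul r).trace_moment_ne hN hN0 hι ?_ ?_ ?_
  · exact (mul_le_of_le_one_left hs0 hr1).trans hs
  · refine le_trans ?_ hV
    gcongr
    exact mul_le_of_le_one_left hV0 hr1
  · rw [gaussianE_trace_seriesPoly_smul, hrN, div_mul_cancel₀ _ hτ0.ne']

end MomentBounds

/-! ### Expected norms -/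

section NormBounds

variable {ι κ : Type*} [Fintype ι] [DecidableEq ι] [Fintype κ]
variable {A : κ → Matrix ι ι ℝ} {s V : ℝ}

lemma integrable_norm_series (A : κ → Matrix ι ι ℝ) :
    Integrable (fun x : κ → ℝ => ‖∑ k, x k • A k‖) (stdGaussianPi κ) := by
  refine Integrable.norm (integrable_finsetSum _ fun k _ => Integrable.smul_const ?_ _)
  simpa using integrable_eval_mvPolynomial (MvPolynomial.X k : MvPolynomial κ ℝ)

/-- Passage from the moment estimate to the expected norm, at a scale `R`. -/
lemma CoeffBound.integral_norm_le_of_scale [Nonempty ι] (h : CoeffBound A s V) {N : ℕ}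
    (hN : Even N) (hN0 : N ≠ 0) (hι : (Fintype.card ι : ℝ) ≤ 2 ^ N) {R : ℝ} (hR : 0 < R)
    (hs : 100 * s ≤ R ^ 2) (hV : 100 * (N ^ 3 * V) ≤ R ^ 2) :
    ∫ x, ‖∑ k, x k • A k‖ ∂stdGaussianPi κ ≤ 4 * R := by
  have hR2 : 0 < R ^ 2 := by positivity
  have hB := h.smul R⁻¹
  have hmom := hB.trace_moment_le hN hN0 hι
    (by rw [inv_pow, inv_mul_le_iff₀ hR2]; linarith)
    (by rw [inv_pow, mul_left_comm, inv_mul_le_iff₀ hR2]; linarith)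
  set p : MvPolynomial κ ℝ := (seriesPoly (fun k => R⁻¹ • A k) ^ N).trace with hp
  set q : MvPolynomial κ ℝ := MvPolynomial.C (2 * R) *
    (MvPolynomial.C 1 + MvPolynomial.C (2 ^ N)⁻¹ * p) with hq
  have hle : ∀ x : κ → ℝ, ‖∑ k, x k • A k‖ ≤ MvPolynomial.eval x q := by
    intro x
    set X := ∑ k, x k • R⁻¹ • A k with hX
    have hXt : Xᵀ = X := hB.transpose_series x
    have e1 : ∑ k, x k • A k = R • X := by
      rw [hX, Finset.smul_sum]
      refine Finset.sum_congr rfl fun k _ => ?_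
      rw [smul_smul, smul_smul]; congr 1; field_simp
    have h1 := norm_pow_le_trace_pow hXt hN
    have h2 := even_pow_le_one_add hN (Nat.one_le_iff_ne_zero.2 hN0) (‖X‖ / 2)
    rw [pow_one, abs_of_nonneg (by positivity), div_pow, div_eq_inv_mul (‖X‖ ^ N)] at h2
    have h3 : (2 ^ N : ℝ)⁻¹ * ‖X‖ ^ N ≤ (2 ^ N)⁻¹ * (X ^ N).trace := by gcongr
    have e2 : MvPolynomial.eval x q = 2 * R * (1 + (2 ^ N)⁻¹ * (X ^ N).trace) := by
      simp only [hq, hp, map_mul, map_add, MvPolynomial.eval_C, eval_trace, map_pow,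
        map_eval_seriesPoly, hX]
    rw [e1, e2, norm_smul, Real.norm_eq_abs, abs_of_pos hR]
    calc R * ‖X‖ = 2 * R * (‖X‖ / 2) := by ring
      _ ≤ _ := by gcongr; linarith
  refine (integral_mono (integrable_norm_series A) (integrable_eval_mvPolynomial q) hle).trans ?_
  change gaussianE q ≤ _
  rw [hq, gaussianE_C_mul, map_add, gaussianE_C, gaussianE_C_mul]
  have h5 : (2 ^ N : ℝ)⁻¹ * gaussianE p ≤ 1 := by
    rw [inv_mul_le_iff₀ (by positivity), mul_one]; exact hmom.trans hι
  nlinarith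

/-- The expected norm of a Gaussian series of symmetric matrices, with dimension dependence only
through `N` with `card ι ≤ 2 ^ N`. -/
theorem CoeffBound.integral_norm_le [Nonempty ι] (h : CoeffBound A s V) {N : ℕ}
    (hN : Even N) (hN0 : N ≠ 0) (hι : (Fintype.card ι : ℝ) ≤ 2 ^ N) :
    ∫ x, ‖∑ k, x k • A k‖ ∂stdGaussianPi κ ≤ 40 * (√s + N ^ 2 * √V) := by
  have hs0 := h.variance_nonneg
  have hV0 := h.covariance_nonneg
  have hN1 : (1 : ℝ) ≤ N := by exact_mod_cast Nat.one_le_iff_ne_zero.2 hN0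
  -- the slack `t` keeps the scale positive when all coefficients vanish
  refine le_of_forall_pos_le_add fun t ht => ?_
  set a := √s with ha
  set b := (N : ℝ) ^ 2 * √V with hb
  have ha0 : 0 ≤ a := by positivity
  have hb0 : 0 ≤ b := by positivity
  have ha2 : a ^ 2 = s := Real.sq_sqrt hs0
  have hb2 : N ^ 3 * V ≤ b ^ 2 := by
    rw [hb, mul_pow, Real.sq_sqrt hV0, ← pow_mul]
    gcongr
    norm_num
  refine (h.integral_norm_le_of_scale hN hN0 hι (R := 10 * (a + b) + t / 4) (by positivity)
    ?_ ?_).trans (by linarith)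
  · rw [← ha2]
    calc 100 * a ^ 2 = (10 * a) ^ 2 := by ring
      _ ≤ _ := by gcongr; linarith
  · calc _ ≤ (10 * b) ^ 2 := by rw [mul_pow]; linarith
      _ ≤ _ := by gcongr; linarith

lemma dotProduct_mulVec_le_norm (M : Matrix ι ι ℝ) (u w : ι → ℝ) :
    u ⬝ᵥ M *ᵥ w ≤ ‖M‖ * (√(∑ i, u i ^ 2) * √(∑ i, w i ^ 2)) := by
  refine (Real.sum_mul_le_sqrt_mul_sqrt _ u (M *ᵥ w)).trans ?_
  have h := Real.sqrt_le_sqrt (sum_sq_mulVec_le M w)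
  rw [Real.sqrt_mul (sq_nonneg _), Real.sqrt_sq (norm_nonneg _)] at h
  calc _ ≤ √(∑ i, u i ^ 2) * (‖M‖ * √(∑ i, w i ^ 2)) := by gcongr
    _ = _ := by ring

lemma dotProduct_mulVec_self_le_norm (M : Matrix ι ι ℝ) (w : ι → ℝ) :
    w ⬝ᵥ M *ᵥ w ≤ ‖M‖ * ∑ i, w i ^ 2 := by
  refine (dotProduct_mulVec_le_norm M w w).trans_eq ?_
  rw [Real.mul_self_sqrt (Finset.sum_nonneg fun _ _ => sq_nonneg _)]

/-- The symmetric dilation of a square matrix. -/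
def dilation (M : Matrix ι ι ℝ) : Matrix (ι ⊕ ι) (ι ⊕ ι) ℝ := Matrix.fromBlocks 0 M Mᵀ 0

omit [Fintype ι] [DecidableEq ι] in
lemma sum_smul_dilation (c : κ → ℝ) (A : κ → Matrix ι ι ℝ) :
    ∑ k, c k • dilation (A k) = dilation (∑ k, c k • A k) := by
  ext i j
  rcases i with i | i <;> rcases j with j | j <;> simp [dilation, Matrix.sum_apply]

lemma norm_le_norm_dilation (M : Matrix ι ι ℝ) : ‖M‖ ≤ ‖dilation M‖ := by
  refine matrix_norm_le_of_bilin _ (norm_nonneg _) fun u w => ?_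
  have h := dotProduct_mulVec_le_norm (dilation M) (Sum.elim u 0) (Sum.elim 0 w)
  simpa [dilation, Matrix.fromBlocks_mulVec, dotProduct] using h

omit [DecidableEq ι] in
lemma frobSq_dilation (M : Matrix ι ι ℝ) : frobSq (dilation M) = 2 * frobSq M := by
  have : frobSq (dilation M) = frobSq M + frobSq Mᵀ := by
    simp [frobSq, dilation]
  rw [this, frobSq_transpose, two_mul]

lemma sum_sum_sq_mulVec_le (A : κ → Matrix ι ι ℝ) (w : ι → ℝ) :
    ∑ k, ∑ i, (A k *ᵥ w) i ^ 2 ≤ ‖∑ k, (A k)ᵀ * A k‖ * ∑ i, w i ^ 2 := by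
  refine le_trans (le_of_eq ?_) (dotProduct_mulVec_self_le_norm _ w)
  rw [Matrix.sum_mulVec, dotProduct_sum]
  refine Finset.sum_congr rfl fun k _ => ?_
  rw [← Matrix.mulVec_mulVec, Matrix.dotProduct_mulVec, ← Matrix.mulVec_transpose,
    Matrix.transpose_transpose]
  simp [dotProduct, sq]

lemma coeffBound_dilation (A : κ → Matrix ι ι ℝ) {v : ℝ}
    (hcov : ∀ c : κ → ℝ, frobSq (∑ k, c k • A k) ≤ v ^ 2 * ∑ k, c k ^ 2) :
    CoeffBound (fun k => dilation (A k))
      (‖∑ k, (A k)ᵀ * A k‖ + ‖∑ k, A k * (A k)ᵀ‖) (2 * v ^ 2) where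
  symm k := by simp [dilation, Matrix.fromBlocks_transpose]
  variance_nonneg := by positivity
  covariance_nonneg := by positivity
  variance w := by
    have h1 := sum_sum_sq_mulVec_le A (w ∘ Sum.inr)
    have h2 := sum_sum_sq_mulVec_le (fun k => (A k)ᵀ) (w ∘ Sum.inl)
    simp only [Matrix.transpose_transpose] at h2
    have e : ∑ k, ∑ i, (dilation (A k) *ᵥ w) i ^ 2 =
        ∑ k, ∑ i, (A k *ᵥ (w ∘ Sum.inr)) i ^ 2 +
          ∑ k, ∑ i, ((A k)ᵀ *ᵥ (w ∘ Sum.inl)) i ^ 2 := by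
      rw [← Finset.sum_add_distrib]
      refine Finset.sum_congr rfl fun k _ => ?_
      rw [Fintype.sum_sum_type, dilation, Matrix.fromBlocks_mulVec]
      simp
    have h3 : 0 ≤ ∑ i, (w ∘ Sum.inl) i ^ 2 := Finset.sum_nonneg fun _ _ => sq_nonneg _
    have h4 : 0 ≤ ∑ i, (w ∘ Sum.inr) i ^ 2 := Finset.sum_nonneg fun _ _ => sq_nonneg _
    have e2 : ∑ i, w i ^ 2 = ∑ i, (w ∘ Sum.inl) i ^ 2 + ∑ i, (w ∘ Sum.inr) i ^ 2 :=
      Fintype.sum_sum_type _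
    rw [e, e2]
    nlinarith [norm_nonneg (∑ k, (A k)ᵀ * A k), norm_nonneg (∑ k, A k * (A k)ᵀ),
      mul_nonneg (norm_nonneg (∑ k, (A k)ᵀ * A k)) h3,
      mul_nonneg (norm_nonneg (∑ k, A k * (A k)ᵀ)) h4]
  covariance c := by
    rw [sum_smul_dilation, frobSq_dilation, mul_assoc]
    exact mul_le_mul_of_nonneg_left (hcov c) zero_le_two

end NormBounds

/-! ### Orthogonal coefficients -/

section Orthogonal

variable {n d : ℕ} {A : Fin n → Matrix (Fin d) (Fin d) ℝ}

lemma frobSq_eq_trace (M : Matrix (Fin d) (Fin d) ℝ) : frobSq M = (M * Mᵀ).trace := by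
  simp [frobSq, Matrix.trace, Matrix.mul_apply, sq]

lemma frobeniusNorm_sq (M : Matrix (Fin d) (Fin d) ℝ) : frobeniusNorm M ^ 2 = frobSq M := by
  rw [frobeniusNorm, Matrix.trace_mul_comm, ← frobSq_eq_trace, Real.sq_sqrt (frobSq_nonneg M)]

lemma frobeniusNorm_le_iSup (A : Fin n → Matrix (Fin d) (Fin d) ℝ) (k : Fin n) :
    frobeniusNorm (A k) ≤ ⨆ k, frobeniusNorm (A k) :=
  le_ciSup (f := fun k => frobeniusNorm (A k)) (Set.finite_range _).bddAbove k

lemma iSup_frobeniusNorm_nonneg (A : Fin n → Matrix (Fin d) (Fin d) ℝ) :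
    0 ≤ ⨆ k, frobeniusNorm (A k) :=
  Real.iSup_nonneg fun _ => Real.sqrt_nonneg _

/-- Orthogonality of the coefficients makes the covariance operator diagonal, with the squared
Frobenius norms as eigenvalues. -/
lemma FrobeniusOrthogonal.frobSq_sum_smul_le (hA : FrobeniusOrthogonal A) (c : Fin n → ℝ) :
    frobSq (∑ k, c k • A k) ≤ (⨆ k, frobeniusNorm (A k)) ^ 2 * ∑ k, c k ^ 2 := by
  have e : frobSq (∑ k, c k • A k) = ∑ k, c k ^ 2 * frobSq (A k) := by
    rw [frobSq_eq_trace, Matrix.transpose_sum, Finset.sum_mul, Matrix.trace_sum]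
    refine Finset.sum_congr rfl fun k _ => ?_
    rw [Finset.mul_sum, Matrix.trace_sum, Finset.sum_eq_single k]
    · rw [frobSq_eq_trace]; simp [sq, mul_assoc]
    · intro l _ hl
      simp [hA k l hl.symm]
    · simp
  rw [e, Finset.mul_sum]
  refine Finset.sum_le_sum fun k _ => ?_
  rw [mul_comm, ← frobeniusNorm_sq]
  refine mul_le_mul_of_nonneg_right ?_ (sq_nonneg _)
  exact pow_le_pow_left₀ (Real.sqrt_nonneg _) (frobeniusNorm_le_iSup A k) 2

lemma FrobeniusOrthogonal.integral_norm_le [NeZero d] (hA : FrobeniusOrthogonal A) {N : ℕ}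
    (hN : Even N) (hN0 : N ≠ 0) (hd : 2 * d ≤ 2 ^ N) :
    ∫ x, ‖∑ k, x k • A k‖ ∂stdGaussianPi (Fin n) ≤
      40 * (√‖∑ k, (A k)ᵀ * A k‖ + √‖∑ k, A k * (A k)ᵀ‖ +
        2 * N ^ 2 * ⨆ k, frobeniusNorm (A k)) := by
  have hv := iSup_frobeniusNorm_nonneg A
  set v := ⨆ k, frobeniusNorm (A k)
  have h := (coeffBound_dilation A hA.frobSq_sum_smul_le).integral_norm_le hN hN0 (by
    rw [Fintype.card_sum, Fintype.card_fin]; exact_mod_cast (by omega : d + d ≤ 2 ^ N))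
  have h1 : ∫ x, ‖∑ k, x k • A k‖ ∂stdGaussianPi (Fin n) ≤
      ∫ x, ‖∑ k, x k • dilation (A k)‖ ∂stdGaussianPi (Fin n) := by
    refine integral_mono (integrable_norm_series _) (integrable_norm_series _) fun x => ?_
    simp only [sum_smul_dilation]
    exact norm_le_norm_dilation _
  have h2 : √(‖∑ k, (A k)ᵀ * A k‖ + ‖∑ k, A k * (A k)ᵀ‖) ≤
      √‖∑ k, (A k)ᵀ * A k‖ + √‖∑ k, A k * (A k)ᵀ‖ := by
    rw [Real.sqrt_le_left (by positivity), add_sq, Real.sq_sqrt (norm_nonneg _),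
      Real.sq_sqrt (norm_nonneg _)]
    linarith [mul_nonneg (Real.sqrt_nonneg ‖∑ k, (A k)ᵀ * A k‖)
      (Real.sqrt_nonneg ‖∑ k, A k * (A k)ᵀ‖)]
  have h3 : √(2 * v ^ 2) ≤ 2 * v := by
    rw [Real.sqrt_le_left (by positivity)]; nlinarith [sq_nonneg v]
  have h4 : (N : ℝ) ^ 2 * √(2 * v ^ 2) ≤ 2 * N ^ 2 * v := by
    calc _ ≤ (N : ℝ) ^ 2 * (2 * v) := by gcongr
      _ = _ := by ring
  linarith

/-- The bound with `(log d) ^ 2`. In dimension one the logarithm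
vanishes, and the Frobenius term is absorbed by the variance term. -/
lemma FrobeniusOrthogonal.integral_norm_le_log (hA : FrobeniusOrthogonal A) :
    ∫ x, ‖∑ k, x k • A k‖ ∂stdGaussianPi (Fin n) ≤
      10000 * (√‖∑ k, (A k)ᵀ * A k‖ + √‖∑ k, A k * (A k)ᵀ‖ +
        Real.log d ^ 2 * ⨆ k, frobeniusNorm (A k)) := by
  have hv := iSup_frobeniusNorm_nonneg A
  rcases Nat.eq_zero_or_pos d with rfl | hd
  · have : ∀ x : Fin n → ℝ, ‖∑ k, x k • A k‖ = 0 := fun x => by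
      rw [Subsingleton.elim (∑ k, x k • A k) 0, norm_zero]
    simp only [this, integral_zero]
    positivity
  have : NeZero d := ⟨hd.ne'⟩
  have ha := Real.sqrt_nonneg ‖∑ k, (A k)ᵀ * A k‖
  have hb := Real.sqrt_nonneg ‖∑ k, A k * (A k)ᵀ‖
  rcases Nat.lt_or_ge 1 d with hd1 | hd1
  · -- an even `N` of order `log d` with `2 d ≤ 2 ^ N`
    set L := Nat.clog 2 (2 * d) with hL
    have hL1 : 2 * d ≤ 2 ^ L := Nat.le_pow_clog (by norm_num) _
    have hL0 : 0 < L := Nat.clog_pos (by norm_num) (by omega)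
    have hL2 : 2 ^ L ≤ d ^ 3 := by
      have h1 := Nat.pow_pred_clog_lt_self (b := 2) (by norm_num) (show 1 < 2 * d by omega)
      have h3 : 2 ^ L = 2 * 2 ^ L.pred := by
        rw [← pow_succ']; congr 1; exact (Nat.succ_pred_eq_of_pos hL0).symm
      have h4 : 2 * 2 ≤ d * d := Nat.mul_le_mul hd1 hd1
      have h5 : d ^ 3 = d * d * d := by ring
      rw [h3, h5]
      nlinarith
    have hlog : (L : ℝ) * Real.log 2 ≤ 3 * Real.log d := by
      have h1 : Real.log ((2 : ℝ) ^ L) ≤ Real.log ((d : ℝ) ^ 3) :=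
        Real.log_le_log (by positivity) (by exact_mod_cast hL2)
      rw [Real.log_pow, Real.log_pow] at h1
      exact_mod_cast h1
    have hN9 : ((2 * L : ℕ) : ℝ) ≤ 9 * Real.log d := by
      push_cast
      nlinarith [Real.log_two_gt_d9, Nat.cast_nonneg (α := ℝ) L]
    have h := hA.integral_norm_le (N := 2 * L) (even_two_mul _) (by omega)
      (hL1.trans (Nat.pow_le_pow_right (by norm_num) (by omega)))
    have hsq : ((2 * L : ℕ) : ℝ) ^ 2 ≤ 81 * Real.log d ^ 2 := by
      calc _ ≤ (9 * Real.log d) ^ 2 := by gcongr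
        _ = _ := by ring
    have h6 : 2 * ((2 * L : ℕ) : ℝ) ^ 2 * (⨆ k, frobeniusNorm (A k)) ≤
        162 * (Real.log d ^ 2 * ⨆ k, frobeniusNorm (A k)) := by
      calc _ ≤ 2 * (81 * Real.log d ^ 2) * (⨆ k, frobeniusNorm (A k)) := by gcongr
        _ = _ := by ring
    have h7 : 0 ≤ Real.log d ^ 2 * ⨆ k, frobeniusNorm (A k) := by positivity
    linarith
  · obtain rfl : d = 1 := by omega
    have h := hA.integral_norm_le (N := 2) even_two (by norm_num) (by norm_num)
    have h1 : ⨆ k, frobeniusNorm (A k) ≤ √‖∑ k, (A k)ᵀ * A k‖ := by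
      refine Real.iSup_le (fun k => ?_) ha
      refine Real.sqrt_le_sqrt ?_
      have h2 := dotProduct_mulVec_self_le_norm (∑ k, (A k)ᵀ * A k) 1
      have h3 : ((A k)ᵀ * A k).trace ≤ ∑ k, ((A k)ᵀ * A k).trace := by
        refine Finset.single_le_sum (f := fun k => ((A k)ᵀ * A k).trace) (fun k _ => ?_)
          (Finset.mem_univ k)
        rw [Matrix.trace_mul_comm, ← frobSq_eq_trace]; exact frobSq_nonneg _
      refine h3.trans ?_
      rw [← Matrix.trace_sum]
      simpa [Matrix.trace, dotProduct, Matrix.mulVec] using h2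
    norm_num at h ⊢
    linarith

lemma IsIIDStdGaussian.map_eq {Ω : Type*} [MeasurableSpace Ω] {μ : Measure Ω}
    [IsProbabilityMeasure μ] {g : Fin n → Ω → ℝ} (hg : IsIIDStdGaussian μ g) :
    μ.map (fun ω k => g k ω) = stdGaussianPi (Fin n) := by
  rw [(iIndepFun_iff_map_fun_eq_pi_map fun k => (hg.1 k).aemeasurable).1 hg.2, stdGaussianPi]
  congr 1
  funext k
  exact (hg.1 k).map_eq

lemma FrobeniusOrthogonal.integral_norm_gaussian_le (hA : FrobeniusOrthogonal A) {Ω : Type*}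
    [MeasurableSpace Ω] {μ : Measure Ω} [IsProbabilityMeasure μ] {g : Fin n → Ω → ℝ}
    (hg : IsIIDStdGaussian μ g) :
    Integrable (fun ω => ‖∑ k, g k ω • A k‖) μ ∧
      ∫ ω, ‖∑ k, g k ω • A k‖ ∂μ ≤
        10000 * (√‖∑ k, (A k)ᵀ * A k‖ + √‖∑ k, A k * (A k)ᵀ‖ +
          Real.log d ^ 2 * ⨆ k, frobeniusNorm (A k)) := by
  have hm : AEMeasurable (fun ω k => g k ω) μ :=
    aemeasurable_pi_lambda _ fun k => (hg.1 k).aemeasurable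
  have hi := integrable_norm_series A
  rw [← hg.map_eq] at hi
  refine ⟨(integrable_map_measure hi.aestronglyMeasurable hm).1 hi, ?_⟩
  refine le_trans (le_of_eq ?_) hA.integral_norm_le_log
  rw [← hg.map_eq]
  exact (integral_map hm hi.aestronglyMeasurable).symm

end Orthogonal

lemma log_sq_le_rpow {ε : ℝ} (hε : 0 < ε) (d : ℕ) :
    Real.log d ^ 2 ≤ (4 / ε ^ 2) * (d : ℝ) ^ ε := by
  have hd0 : (0 : ℝ) ≤ d := Nat.cast_nonneg d
  have h := Real.log_le_rpow_div hd0 (half_pos hε)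
  have h1 : 0 ≤ Real.log d := Real.log_natCast_nonneg d
  calc Real.log d ^ 2 ≤ ((d : ℝ) ^ (ε / 2) / (ε / 2)) ^ 2 := by gcongr
    _ = (4 / ε ^ 2) * ((d : ℝ) ^ (ε / 2)) ^ 2 := by field_simp; ring
    _ = _ := by
        rw [← Real.rpow_mul_natCast hd0]
        norm_num

theorem theorem2 :
    (∀ ε : ℝ, 0 < ε → ∃ C : ℝ, 0 < C ∧
      ∀ (n d : ℕ) (A : Fin n → Matrix (Fin d) (Fin d) ℝ)
        (Ω : Type u) [MeasurableSpace Ω] (μ : Measure Ω) [IsProbabilityMeasure μ]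
        (g : Fin n → Ω → ℝ),
        FrobeniusOrthogonal A → IsIIDStdGaussian μ g →
        Integrable (fun ω => ‖∑ k, g k ω • A k‖) μ ∧
        ∫ ω, ‖∑ k, g k ω • A k‖ ∂μ ≤
          C * (√‖∑ k, (A k)ᵀ * A k‖ + √‖∑ k, A k * (A k)ᵀ‖ +
            (d : ℝ) ^ ε * ⨆ k, frobeniusNorm (A k))) ∧
    (∃ C : ℝ, 0 < C ∧
      ∀ (n d : ℕ) (A : Fin n → Matrix (Fin d) (Fin d) ℝ)
        (Ω : Type u) [MeasurableSpace Ω] (μ : Measure Ω) [IsProbabilityMeasure μ]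
        (g : Fin n → Ω → ℝ),
        FrobeniusOrthogonal A → (∀ k i j, 0 ≤ A k i j) → IsIIDStdGaussian μ g →
        Integrable (fun ω => ‖∑ k, g k ω • A k‖) μ ∧
        ∫ ω, ‖∑ k, g k ω • A k‖ ∂μ ≤
          C * (√‖∑ k, (A k)ᵀ * A k‖ + √‖∑ k, A k * (A k)ᵀ‖ +
            Real.log d ^ 2 * ⨆ k, frobeniusNorm (A k))) := by
  constructor
  · intro ε hε
    refine ⟨10000 * (1 + 4 / ε ^ 2), by positivity, fun n d A Ω _ μ _ g hA hg => ?_⟩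
    obtain ⟨h1, h2⟩ := hA.integral_norm_gaussian_le hg
    refine ⟨h1, h2.trans ?_⟩
    have hv := iSup_frobeniusNorm_nonneg A
    have ha := Real.sqrt_nonneg ‖∑ k, (A k)ᵀ * A k‖
    have hb := Real.sqrt_nonneg ‖∑ k, A k * (A k)ᵀ‖
    have hlog := mul_le_mul_of_nonneg_right (log_sq_le_rpow hε d) hv
    have hC : 0 ≤ 4 / ε ^ 2 := by positivity
    have hdv : 0 ≤ (d : ℝ) ^ ε * ⨆ k, frobeniusNorm (A k) := by positivity
    rw [mul_assoc (10000 : ℝ)]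
    refine mul_le_mul_of_nonneg_left ?_ (by norm_num)
    rw [add_mul, one_mul]
    nlinarith [mul_nonneg hC ha, mul_nonneg hC hb]
  · exact ⟨10000, by norm_num, fun n d A Ω _ μ _ g hA _ hg => hA.integral_norm_gaussian_le hg⟩
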